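/- Let $d\ge 1$, $G(t,x)=(2\pi t)^{-d/2}e^{-|x|^2/(2t)}$, and let $f:\mathbb R\to\mathbb R$ be continuous and such that, for some $\kappa\in\mathbb R$, $K>0$, $\nu\ge 0$, one has $f(u_2)-f(u_1)\le\kappa(u_2-u_1)$ for all $u_1<u_2$ and $|f(u)|\le Ke^{K|u|^\nu}$ for all $u$. For $T>0$, $x_0\in\mathbb R^d$, $\theta>0$ let $C_{x_0,\theta}([0,T]\times\mathbb R^d)$ be the space of continuous $\psi:[0,T]\times\mathbb R^d\to\mathbb R$ with $\lim_{|x|\to\infty}\sup_{t\in[0,T]}\frac{|\psi(t,x)|}{1+|x-x_0|^\theta}=0$, normed by $|\psi|_{x_0,\theta}=\sup_{t\in[0,T]}\sup_{x\in\mathbb R^d}\frac{|\psi(t,x)|}{1+|x-x_0|^\theta}$; it contains the space $C_b([0,T]\times\mathbb R^d)$ of bounded continuous functions. For $z\in C_b([0,T]\times\mathbb R^d)$ let $u=\mathcal M(z)\in C_b([0,T]\times\mathbb R^d)$ be the solution of $$u(t,x)=\int_0^t\int_{\mathbb R^d}G(t-s,x-y)f(u(s,y))\,dy\,ds+z(t,x),\qquad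 (t,x)\in[0,T]\times\mathbb R^d; \tag{1}$$ it exists and is unique in $C_b([0,T]\times\mathbb R^d)$. **Theorem.** Let $\theta>0$. (i) For all $T>0$ and $x_0\in\mathbb R^d$, $\mathcal M$ extends uniquely to a continuous map from $C_{x_0,\theta}([0,T]\times\mathbb R^d)$ to itself, again denoted $\mathcal M$. (ii) There is a constant $C>0$ depending only on $d,\theta,\kappa$ (in particular, not on $x_0$ or $T$) such that $|\mathcal M(z_1)-\mathcal M(z_2)|_{x_0,\theta}\le Ce^{CT}|z_1-z_2|_{x_0,\theta}$ for all $T>0$, $x_0\in\mathbb R^d$ and $z_1,z_2\in C_{x_0,\theta}([0,T]\times\mathbb R^d)$. (iii) There is a constant $C'>0$ depending only on $d,\theta,\kappa$ and an upper bound for $|f(0)|$ such that $|\mathcal M(z)|_{x_0,\theta}\le C'e^{C'T}(1+|z|_{x_0,\theta})$ for all $T>0$, $x_0\in\mathbb R^d$ and $z\in C_{x_0,\theta}([0,T]\times\mathbb R^d)$. (iv) If $\theta<2/\nu$ (with $2/0=\infty$), then for every $z\in C_{x_0,\theta}([0,T]\times\mathbb R^d)$ the function $u=\mathcal M(z)$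 satisfies (1), the integral converging absolutely. (v) If $\theta>2/\nu$, the integrand in (1) need not be integrable: for all $\nu>0$, $\theta>2/\nu$, $T>0$ and $x_0\in\mathbb R^d$ there are a function $f$ satisfying the above assumptions with this $\nu$ (and some $\kappa,K$), a $z\in C_{x_0,\theta}([0,T]\times\mathbb R^d)$, times $0\le s<t\le T$ and a point $x\in\mathbb R^d$ such that $y\mapsto G(t-s,x-y)f(\mathcal M(z)(s,y))$ is not integrable over $\mathbb R^d$. -/

import Mathlib

open Set Filter Topology MeasureTheory
open scoped BoundedContinuousFunction

noncomputable section

/-- The Euclidean space `ℝ^d`. -/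
abbrev Space (d : ℕ) : Type := EuclideanSpace ℝ (Fin d)

/-- The set `[0,T] × ℝ^d`. -/
abbrev SpaceTime (T : ℝ) (d : ℕ) : Type := Icc (0 : ℝ) T × Space d

/-- The heat kernel `G(t,x) = (2πt)^{-d/2} exp(-|x|²/(2t))`, the fundamental solution of
`∂ₜ = ½ Δ`.  Only its values for `t > 0` matter. -/
def heatKernel {d : ℕ} (t : ℝ) (x : Space d) : ℝ :=
  (2 * Real.pi * t) ^ (-(d : ℝ) / 2) * Real.exp (-‖x‖ ^ 2 / (2 * t))

/-- The assumptions on the drift `f`: continuity, the one-sided Lipschitz condition with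
constant `κ`, and the growth bound `|f(u)| ≤ K exp(K |u|^ν)`. -/
structure DriftAssumption (f : ℝ → ℝ) (κ K ν : ℝ) : Prop where
  continuous : Continuous f
  oneSidedLipschitz : ∀ u₁ u₂ : ℝ, u₁ < u₂ → f u₂ - f u₁ ≤ κ * (u₂ - u₁)
  K_pos : 0 < K
  ν_nonneg : 0 ≤ ν
  growth : ∀ u : ℝ, |f u| ≤ K * Real.exp (K * |u| ^ ν)

/-- The integrand `(s,y) ↦ G(t-s,x-y) f(u(s,y))`.  The clamp `projIcc` is the identity
for `s ∈ [0,T]`, the only times that are used. -/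
def duhamelIntegrand {T : ℝ} {d : ℕ} (hT : 0 < T) (f : ℝ → ℝ) (u : SpaceTime T d → ℝ)
    (t : ℝ) (x : Space d) (s : ℝ) (y : Space d) : ℝ :=
  heatKernel (t - s) (x - y) * f (u (projIcc 0 T hT.le s, y))

/-- `u` solves `u(t,x) = ∫₀ᵗ ∫ G(t-s,x-y) f(u(s,y)) dy ds + z(t,x)` on `[0,T] × ℝ^d`,
where the integral converges absolutely. -/
def IsSolution {T : ℝ} {d : ℕ} (hT : 0 < T) (f : ℝ → ℝ) (z u : SpaceTime T d → ℝ) : Prop :=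
  ∀ (t : Icc (0 : ℝ) T) (x : Space d),
    Integrable (fun p : ℝ × Space d => duhamelIntegrand hT f u t x p.1 p.2)
      ((volume.restrict (Ioc (0 : ℝ) t)).prod volume) ∧
    u (t, x) = (∫ s in (0 : ℝ)..t, ∫ y : Space d, duhamelIntegrand hT f u t x s y) + z (t, x)

open Classical in
/-- The map `M` on `C_b([0,T] × ℝ^d)`: `M z` is the solution in `C_b([0,T] × ℝ^d)` of the
integral equation with datum `z` (with default value `0` should there be none). -/
def solutionMap {T : ℝ} {d : ℕ} (hT : 0 < T) (f : ℝ → ℝ) (z : SpaceTime T d →ᵇ ℝ) :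
    SpaceTime T d →ᵇ ℝ :=
  if h : ∃ u : SpaceTime T d →ᵇ ℝ, IsSolution hT f z u then h.choose else 0

/-- The weight `1 + |x - x₀|^θ`. -/
def weight {d : ℕ} (x₀ : Space d) (θ : ℝ) (x : Space d) : ℝ := 1 + ‖x - x₀‖ ^ θ

theorem one_le_weight {d : ℕ} (x₀ : Space d) (θ : ℝ) (x : Space d) : 1 ≤ weight x₀ θ x :=
  le_add_of_nonneg_right (Real.rpow_nonneg (norm_nonneg _) _)

theorem weight_pos {d : ℕ} (x₀ : Space d) (θ : ℝ) (x : Space d) : 0 < weight x₀ θ x :=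
  one_pos.trans_le (one_le_weight x₀ θ x)

theorem bddAbove_slice {T : ℝ} {d : ℕ} (x₀ : Space d) (θ : ℝ) (ψ : C(SpaceTime T d, ℝ))
    (x : Space d) : BddAbove (range fun t : Icc (0 : ℝ) T => |ψ (t, x)| / weight x₀ θ x) :=
  (isCompact_range (by fun_prop)).bddAbove

/-- The continuous functions `ψ` on `[0,T] × ℝ^d` such that
`sup_{t ∈ [0,T]} |ψ(t,x)| / (1 + |x - x₀|^θ) → 0` as `|x| → ∞`. -/
def weightedSubmodule (T : ℝ) {d : ℕ} (x₀ : Space d) (θ : ℝ) :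
    Submodule ℝ C(SpaceTime T d, ℝ) where
  carrier := {ψ | Tendsto (fun x => ⨆ t : Icc (0 : ℝ) T, |ψ (t, x)| / weight x₀ θ x)
    (Bornology.cobounded (Space d)) (𝓝 0)}
  zero_mem' := by simpa using tendsto_const_nhds
  add_mem' := by
    intro φ ψ hφ hψ
    have h := Tendsto.add hφ hψ
    rw [add_zero] at h
    refine squeeze_zero (fun x => Real.iSup_nonneg fun t => ?_) (fun x => ?_) h
    · exact div_nonneg (abs_nonneg _) (weight_pos x₀ θ x).le
    · refine Real.iSup_le (fun t => ?_) (add_nonneg ?_ ?_)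
      · refine le_trans ?_ (add_le_add (le_ciSup (bddAbove_slice x₀ θ φ x) t)
          (le_ciSup (bddAbove_slice x₀ θ ψ x) t))
        rw [← add_div]
        exact div_le_div_of_nonneg_right (abs_add_le _ _) (weight_pos x₀ θ x).le
      all_goals exact Real.iSup_nonneg fun t => div_nonneg (abs_nonneg _) (weight_pos x₀ θ x).le
  smul_mem' := by
    intro c ψ hψ
    have h := Tendsto.const_mul |c| hψ
    rw [mul_zero] at h
    refine h.congr fun x => ?_
    rw [Real.mul_iSup_of_nonneg (abs_nonneg c)]
    simp [abs_mul, mul_div_assoc]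

/-- The weighted space `C_{x₀,θ}([0,T] × ℝ^d)`.  It carries the norm below and not the
compact-open topology of `C([0,T] × ℝ^d)`. -/
def WeightedC (T : ℝ) {d : ℕ} (x₀ : Space d) (θ : ℝ) : Type := weightedSubmodule T x₀ θ

namespace WeightedC

variable {T : ℝ} {d : ℕ} {x₀ : Space d} {θ : ℝ}

instance : AddCommGroup (WeightedC T x₀ θ) :=
  inferInstanceAs (AddCommGroup (weightedSubmodule T x₀ θ))

instance : Module ℝ (WeightedC T x₀ θ) :=
  inferInstanceAs (Module ℝ (weightedSubmodule T x₀ θ))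

instance : CoeFun (WeightedC T x₀ θ) fun _ => SpaceTime T d → ℝ :=
  ⟨fun ψ => ψ.1⟩

/-- The weighted supremum `sup_{t,x} |ψ(t,x)| / (1 + |x - x₀|^θ)`, which is finite. -/
def wnorm (ψ : WeightedC T x₀ θ) : ℝ := ⨆ p : SpaceTime T d, |ψ p| / weight x₀ θ p.2

theorem ratio_nonneg (ψ : WeightedC T x₀ θ) (p : SpaceTime T d) :
    0 ≤ |ψ p| / weight x₀ θ p.2 :=
  div_nonneg (abs_nonneg _) (weight_pos x₀ θ p.2).le

theorem bddAbove (ψ : WeightedC T x₀ θ) :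
    BddAbove (range fun p : SpaceTime T d => |ψ p| / weight x₀ θ p.2) := by
  have h : ∀ᶠ x in Bornology.cobounded (Space d),
      (⨆ t : Icc (0 : ℝ) T, |ψ (t, x)| / weight x₀ θ x) < 1 :=
    Tendsto.eventually_lt_const one_pos ψ.2
  rw [Metric.cobounded_eq_cocompact] at h
  obtain ⟨S, hS, hSc⟩ := mem_cocompact.1 h
  have hc : Continuous fun p : SpaceTime T d => |ψ p| := ψ.1.continuous.abs
  obtain ⟨B, hB⟩ := ((isCompact_univ (X := Icc (0 : ℝ) T)).prod hS).bddAbove_image hc.continuousOn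
  refine ⟨max B 1, ?_⟩
  rintro _ ⟨⟨t, x⟩, rfl⟩
  by_cases hx : x ∈ S
  · exact le_max_of_le_left ((div_le_self (abs_nonneg _) (one_le_weight x₀ θ x)).trans
      (hB ⟨(t, x), ⟨mem_univ _, hx⟩, rfl⟩))
  · exact le_max_of_le_right ((le_ciSup (bddAbove_slice x₀ θ ψ.1 x) t).trans (hSc hx).le)

theorem ratio_le_wnorm (ψ : WeightedC T x₀ θ) (p : SpaceTime T d) :
    |ψ p| / weight x₀ θ p.2 ≤ wnorm ψ :=
  le_ciSup ψ.bddAbove p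

/-- The weighted supremum norm is a norm. -/
def addGroupNorm (T : ℝ) {d : ℕ} (x₀ : Space d) (θ : ℝ) :
    AddGroupNorm (WeightedC T x₀ θ) where
  toFun ψ := wnorm ψ
  map_zero' := by
    have h : ∀ p, (0 : WeightedC T x₀ θ) p = 0 := fun _ => rfl
    simp [wnorm, h]
  add_le' φ ψ := by
    refine Real.iSup_le (fun p => ?_)
      (add_nonneg (Real.iSup_nonneg φ.ratio_nonneg) (Real.iSup_nonneg ψ.ratio_nonneg))
    refine le_trans ?_ (add_le_add (φ.ratio_le_wnorm p) (ψ.ratio_le_wnorm p))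
    rw [← add_div]
    exact div_le_div_of_nonneg_right (abs_add_le _ _) (weight_pos x₀ θ p.2).le
  neg' ψ := by
    have h : ∀ p, (-ψ) p = -(ψ p) := fun _ => rfl
    simp [wnorm, h]
  eq_zero_of_map_eq_zero' ψ h := by
    refine Subtype.ext (ContinuousMap.ext fun p => ?_)
    have h1 : |ψ p| / weight x₀ θ p.2 = 0 :=
      le_antisymm ((ψ.ratio_le_wnorm p).trans_eq h) (ψ.ratio_nonneg p)
    exact abs_eq_zero.1 ((div_eq_zero_iff.1 h1).resolve_right (weight_pos x₀ θ p.2).ne')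

instance : NormedAddCommGroup (WeightedC T x₀ θ) :=
  (addGroupNorm T x₀ θ).toNormedAddCommGroup

theorem norm_def (ψ : WeightedC T x₀ θ) :
    ‖ψ‖ = ⨆ p : SpaceTime T d, |ψ p| / weight x₀ θ p.2 := rfl

/-- The inclusion of `C_b([0,T] × ℝ^d)` into `C_{x₀,θ}([0,T] × ℝ^d)` for `θ > 0`. -/
def ofBounded (x₀ : Space d) (hθ : 0 < θ) (z : SpaceTime T d →ᵇ ℝ) : WeightedC T x₀ θ :=
  ⟨z.toContinuousMap, by
    have hw : Tendsto (weight x₀ θ) (Bornology.cobounded (Space d)) atTop := by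
      have h1 : Tendsto (fun x : Space d => ‖x - x₀‖) (Bornology.cobounded (Space d)) atTop := by
        refine tendsto_atTop_mono (fun x => norm_sub_norm_le x x₀) ?_
        exact tendsto_atTop_add_const_right _ _ tendsto_norm_cobounded_atTop
      exact tendsto_atTop_add_const_left _ _ ((tendsto_rpow_atTop hθ).comp h1)
    refine squeeze_zero (fun x => Real.iSup_nonneg fun t => ?_) (fun x => ?_)
      (Tendsto.const_div_atTop hw ‖z‖)
    · exact div_nonneg (abs_nonneg _) (weight_pos x₀ θ x).le
    · refine Real.iSup_le (fun t => ?_) (div_nonneg (norm_nonneg _) (weight_pos x₀ θ x).le)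
      exact div_le_div_of_nonneg_right (z.norm_coe_le_norm (t, x)) (weight_pos x₀ θ x).le⟩

theorem ofBounded_apply (x₀ : Space d) (hθ : 0 < θ) (z : SpaceTime T d →ᵇ ℝ)
    (p : SpaceTime T d) : ofBounded x₀ hθ z p = z p := rfl

end WeightedC

/-- `E` is a continuous map of `C_{x₀,θ}([0,T] × ℝ^d)` to itself that extends `M`. -/
def IsContinuousExtension {T : ℝ} {d : ℕ} {x₀ : Space d} {θ : ℝ} (hT : 0 < T) (hθ : 0 < θ)
    (f : ℝ → ℝ) (E : WeightedC T x₀ θ → WeightedC T x₀ θ) : Prop :=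
  Continuous E ∧ ∀ z : SpaceTime T d →ᵇ ℝ,
    E (WeightedC.ofBounded x₀ hθ z) = WeightedC.ofBounded x₀ hθ (solutionMap hT f z)

end

open ProbabilityTheory (stdGaussian)
open scoped RealInnerProductSpace

/-! ### The heat kernel as a scaled standard Gaussian density. -/

section Gaussian

variable {d : ℕ}

/-! Everything rests on one estimate for bounded solutions, whose constant does not see the
Lipschitz constant of the drift. Write `P_t h(x) = E h(x + √t Z)` with `Z` standard Gaussian, and `φ
= (1 + |x - x₀|²)^(θ/2)`. This weight is comparable to `1 + |x - x₀|^θ` and satisfies `P_t φ ≤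
e^(ct) φ` with `c` independent of `x₀` (`heatOp_smoothWeight_le`).

Let `w` be the difference of the Duhamel terms of two solutions and `ζ` the difference of their
data. If `f` is Lipschitz with constant `L`, the one-sided condition says that `f(u₁) - f(u₂) = (c -
L)(u₁ - u₂)` with `0 ≤ c ≤ L + κ`. Rewriting Duhamel's formula with damping `e^(-L(t-s))` replaces
the source `g` by `g + L w = c w + (c - L) ζ` (`duhamel_eq_damped`). The large negative slope is
thus absorbed: a bound for `w` by a multiple of `e^(λt) φ` improves by a factor less than one, and
iteration gives a bound with `λ` depending only on `d`, `θ`, `κ` (`abs_duhamel_le`). This replaces a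
maximum principle and needs no differentiability of solutions.

A continuous one-sided Lipschitz `f` is a locally uniform limit of Lipschitz functions with the same
`κ`, so the estimate gives existence, uniqueness and comparison for bounded data
(`OneSided.exists_isMild`, `IsMild.abs_sub_le`). Hence the solution map is Lipschitz in the weighted
norm on bounded functions. These are dense in a complete space, so the map extends, and both
estimates pass to the limit.

If `θ ν < 2`, then `|f(u)|` grows more slowly than every `e^(ε|x|²)`, uniformly along the truncated
solutions, and dominated convergence preserves the equation. If `θ ν > 2`, a datum `|x - x₀|^α` with
`2/ν < α < θ`, seen at time `0`, where the solution equals its datum, defeats the Gaussian kernel.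
-/

theorem integrable_exp_neg_mul_sq_norm_add_inner {b : ℝ} (hb : 0 < b) (w : Space d) :
    Integrable fun v : Space d => Real.exp (-b * ‖v‖ ^ 2 + ⟪w, v⟫) := by
  have h := (GaussianFourier.integrable_cexp_neg_mul_sq_norm_add (b := (b : ℂ)) (by simpa using hb)
    1 w).norm
  refine h.congr (Eventually.of_forall fun v => ?_)
  simp only [Complex.norm_exp]
  congr 1
  simp [← Complex.ofReal_pow]

theorem integral_exp_neg_mul_sq_norm_add_inner {b : ℝ} (hb : 0 < b) (w : Space d) :
    ∫ v : Space d, Real.exp (-b * ‖v‖ ^ 2 + ⟪w, v⟫) =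
      (Real.pi / b) ^ ((d : ℝ) / 2) * Real.exp (‖w‖ ^ 2 / (4 * b)) := by
  have h := GaussianFourier.integral_cexp_neg_mul_sq_norm_add (b := (b : ℂ)) (by simpa using hb)
    1 w
  have h1 : ∀ v : Space d, Complex.exp (-(b : ℂ) * (‖v‖ : ℂ) ^ 2 + 1 * (⟪w, v⟫ : ℝ)) =
      ((Real.exp (-b * ‖v‖ ^ 2 + ⟪w, v⟫) : ℝ) : ℂ) := by
    intro v; push_cast; simp
  simp_rw [h1, integral_complex_ofReal] at h
  rw [← Complex.ofReal_inj, h, finrank_euclideanSpace_fin]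
  push_cast
  rw [Complex.ofReal_cpow (by positivity)]
  push_cast
  simp

theorem heatKernel_nonneg {t : ℝ} (ht : 0 ≤ t) (x : Space d) : 0 ≤ heatKernel t x := by
  unfold heatKernel; positivity

theorem measurable_heatKernel : Measurable fun p : ℝ × Space d => heatKernel p.1 p.2 := by
  unfold heatKernel; fun_prop

theorem heatKernel_one (v : Space d) :
    heatKernel 1 v = (2 * Real.pi) ^ (-(d : ℝ) / 2) * Real.exp (-(1 / 2) * ‖v‖ ^ 2) := by
  unfold heatKernel; congr 2 <;> ring_nf

theorem integrable_heatKernel_one : Integrable fun v : Space d => heatKernel 1 v := by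
  simp_rw [heatKernel_one]
  simpa using (integrable_exp_neg_mul_sq_norm_add_inner (by norm_num : (0 : ℝ) < 1 / 2)
    (0 : Space d)).const_mul _

theorem measurable_ofReal_heatKernel_one :
    Measurable fun v : Space d => ENNReal.ofReal (heatKernel 1 v) :=
  (measurable_heatKernel.comp (measurable_const.prodMk measurable_id)).ennreal_ofReal

/-- The standard Gaussian measure has the heat kernel at time one as its density. -/
theorem stdGaussian_eq_withDensity :
    stdGaussian (Space d) = volume.withDensity fun v => ENNReal.ofReal (heatKernel 1 v) := by
  have : IsFiniteMeasure ((volume : Measure (Space d)).withDensity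
      fun v => ENNReal.ofReal (heatKernel 1 v)) :=
    isFiniteMeasure_withDensity_ofReal integrable_heatKernel_one.2
  refine Measure.ext_of_charFun ?_
  ext w
  rw [ProbabilityTheory.charFun_stdGaussian, charFun_apply,
    integral_withDensity_eq_integral_toReal_smul measurable_ofReal_heatKernel_one
      (by simp)]
  have h := GaussianFourier.integral_cexp_neg_mul_sq_norm_add (b := (1 / 2 : ℂ)) (by norm_num)
    Complex.I w
  have h1 : ∀ v : Space d, (ENNReal.ofReal (heatKernel 1 v)).toReal •
      Complex.exp ((⟪v, w⟫ : ℝ) * Complex.I) = (((2 * Real.pi) ^ (-(d : ℝ) / 2) : ℝ) : ℂ) *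
        Complex.exp (-(1 / 2 : ℂ) * (‖v‖ : ℂ) ^ 2 + Complex.I * (⟪w, v⟫ : ℝ)) := by
    intro v
    rw [ENNReal.toReal_ofReal (heatKernel_nonneg zero_le_one v), heatKernel_one, Complex.exp_add,
      real_inner_comm, Complex.real_smul]
    push_cast
    ring_nf
  simp_rw [h1]
  rw [integral_const_mul, h, ← mul_assoc, finrank_euclideanSpace_fin]
  have h2 : (((2 * Real.pi) ^ (-(d : ℝ) / 2) : ℝ) : ℂ) *
      ((Real.pi : ℂ) / (1 / 2)) ^ ((d : ℂ) / 2) = 1 := by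
    have : ((Real.pi : ℂ) / (1 / 2)) ^ ((d : ℂ) / 2) =
        (((2 * Real.pi) ^ ((d : ℝ) / 2) : ℝ) : ℂ) := by
      rw [Complex.ofReal_cpow (by positivity)]
      push_cast
      congr 1
      ring
    rw [this, ← Complex.ofReal_mul, ← Real.rpow_add (by positivity)]
    ring_nf
    simp
  rw [h2, one_mul, Complex.I_sq]
  congr 1
  ring

theorem integrable_stdGaussian_iff {h : Space d → ℝ} :
    Integrable h (stdGaussian (Space d)) ↔ Integrable fun v => heatKernel 1 v * h v := by
  rw [stdGaussian_eq_withDensity, integrable_withDensity_iff_integrable_smul'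
    measurable_ofReal_heatKernel_one (by simp)]
  simp_rw [ENNReal.toReal_ofReal (heatKernel_nonneg zero_le_one _), smul_eq_mul]

theorem integral_stdGaussian {h : Space d → ℝ} :
    ∫ v, h v ∂stdGaussian (Space d) = ∫ v, heatKernel 1 v * h v := by
  rw [stdGaussian_eq_withDensity, integral_withDensity_eq_integral_toReal_smul
    measurable_ofReal_heatKernel_one (by simp)]
  simp_rw [ENNReal.toReal_ofReal (heatKernel_nonneg zero_le_one _), smul_eq_mul]

theorem heatKernel_neg_sqrt_smul {t : ℝ} (ht : 0 < t) (v : Space d) :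
    heatKernel t (-(√t • v)) = (√t ^ d)⁻¹ * heatKernel 1 v := by
  unfold heatKernel
  rw [norm_neg, norm_smul, Real.norm_of_nonneg (Real.sqrt_nonneg t), mul_pow, Real.sq_sqrt ht.le,
    Real.mul_rpow (by positivity) ht.le]
  have h1 : (√t ^ d)⁻¹ = t ^ (-(d : ℝ) / 2) := by
    rw [Real.sqrt_eq_rpow, ← Real.rpow_natCast, ← Real.rpow_mul ht.le, ← Real.rpow_neg ht.le]
    congr 1; ring
  have h2 : -(t * ‖v‖ ^ 2) / (2 * t) = -‖v‖ ^ 2 / (2 * 1) := by field_simp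
  rw [h1, h2, mul_one]
  ring_nf

/-- The substitution `y = x + √t v` moves all dependence on `t` from the kernel into the function,
so that one fixed probability measure serves all times. -/
theorem integrable_heatKernel_mul_iff {t : ℝ} (ht : 0 < t) (x : Space d) (h : Space d → ℝ) :
    Integrable (fun y => heatKernel t (x - y) * h y) ↔
      Integrable (fun v => h (x + √t • v)) (stdGaussian (Space d)) := by
  have hs : √t ≠ 0 := (Real.sqrt_pos.2 ht).ne'
  rw [integrable_stdGaussian_iff,
    ← (measurePreserving_add_left volume x).integrable_comp_emb
      (MeasurableEquiv.addLeft x).measurableEmbedding,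
    ← integrable_comp_smul_iff volume
      ((fun y => heatKernel t (x - y) * h y) ∘ fun y => x + y) hs]
  simp_rw [Function.comp_apply, sub_add_cancel_left, heatKernel_neg_sqrt_smul ht, mul_assoc]
  exact integrable_const_mul_iff (IsUnit.mk0 _ (by positivity)) _

theorem integral_heatKernel_mul {t : ℝ} (ht : 0 < t) (x : Space d) (h : Space d → ℝ) :
    ∫ y, heatKernel t (x - y) * h y = ∫ v, h (x + √t • v) ∂stdGaussian (Space d) := by
  have hs : 0 < √t := Real.sqrt_pos.2 ht
  have h1 := Measure.integral_comp_smul volume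
    (fun y => heatKernel t (x - (x + y)) * h (x + y)) (√t)
  rw [integral_stdGaussian, ← integral_add_left_eq_self _ x]
  simp_rw [sub_add_cancel_left, heatKernel_neg_sqrt_smul ht, mul_assoc, integral_const_mul,
    finrank_euclideanSpace_fin] at h1
  rw [abs_of_nonneg (by positivity), smul_eq_mul] at h1
  simp_rw [sub_add_cancel_left]
  exact (mul_left_cancel₀ (by positivity) h1).symm

/-- Gaussian vectors with variances `s` and `t` add up to one with variance `s + t`. -/
theorem map_stdGaussian_prod {s t : ℝ} (hs : 0 ≤ s) (ht : 0 ≤ t) :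
    ((stdGaussian (Space d)).prod (stdGaussian (Space d))).map (fun p => √s • p.1 + √t • p.2) =
      (stdGaussian (Space d)).map fun v => √(s + t) • v := by
  have : ∀ r : ℝ, IsProbabilityMeasure ((stdGaussian (Space d)).map fun v => r • v) := fun r =>
    Measure.isProbabilityMeasure_map (by fun_prop)
  have h2 : ((stdGaussian (Space d)).prod (stdGaussian (Space d))).map
      (fun p => √s • p.1 + √t • p.2) =
      (((stdGaussian (Space d)).map fun v => √s • v).prod
        ((stdGaussian (Space d)).map fun v => √t • v)).map fun p => p.1 + p.2 := by
    rw [Measure.map_prod_map _ _ (by fun_prop) (by fun_prop), Measure.map_map (by fun_prop)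
      (by fun_prop)]
    rfl
  rw [h2]
  -- Characteristic functions multiply under independent sums, and `exp(-s|w|²/2) exp(-t|w|²/2) =
  -- exp(-(s+t)|w|²/2)`.
  refine Measure.ext_of_charFun ?_
  ext w
  have h3 : ∀ r : ℝ, charFun ((stdGaussian (Space d)).map fun v => r • v) w =
      Complex.exp (-(r ^ 2 * ‖w‖ ^ 2 : ℝ) / 2) := by
    intro r
    rw [charFun_map_smul, ProbabilityTheory.charFun_stdGaussian, norm_smul]
    congr 2
    push_cast
    rw [mul_pow, ← Complex.ofReal_pow, Real.norm_eq_abs, sq_abs]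
    push_cast
    ring
  rw [ProbabilityTheory.charFun_map_add_prod_eq_mul, Pi.mul_apply, h3, h3, h3, ← Complex.exp_add,
    Real.sq_sqrt hs, Real.sq_sqrt ht, Real.sq_sqrt (add_nonneg hs ht)]
  congr 1
  push_cast
  ring

end Gaussian

/-! ### The heat semigroup and its action on the polynomial weight. -/

section HeatSemigroup

variable {d : ℕ}

/-- The heat semigroup `P_t h(x) = E h(x + √t Z)`, with `Z` a standard Gaussian vector. -/
noncomputable def heatOp (t : ℝ) (h : Space d → ℝ) (x : Space d) : ℝ :=
  ∫ v, h (x + √t • v) ∂stdGaussian (Space d)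

/-- The semigroup law is Fubini's theorem combined with the additivity of Gaussian variances.
Integrability at time `s + t` is all that Fubini needs, so unbounded weights are allowed. -/
theorem heatOp_heatOp {s t : ℝ} (hs : 0 ≤ s) (ht : 0 ≤ t) {h : Space d → ℝ} (hc : Continuous h)
    {x : Space d} (hi : Integrable (fun v => h (x + √(s + t) • v)) (stdGaussian (Space d))) :
    Integrable (fun v => heatOp t h (x + √s • v)) (stdGaussian (Space d)) ∧
      heatOp s (heatOp t h) x = heatOp (s + t) h x := by
  have hm := map_stdGaussian_prod (d := d) hs ht
  have hcx : Continuous fun y => h (x + y) := by fun_prop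
  have h1 : Integrable (fun y => h (x + y))
      ((stdGaussian (Space d)).map fun v => √(s + t) • v) :=
    (integrable_map_measure hcx.aestronglyMeasurable (by fun_prop)).2 hi
  have h2 : ∫ y, h (x + y) ∂((stdGaussian (Space d)).map fun v => √(s + t) • v) =
      heatOp (s + t) h x :=
    integral_map (by fun_prop) hcx.aestronglyMeasurable
  rw [← hm] at h1 h2
  rw [integrable_map_measure hcx.aestronglyMeasurable (by fun_prop)] at h1
  rw [integral_map (by fun_prop) hcx.aestronglyMeasurable] at h2
  constructor
  · convert h1.integral_prod_left using 2
    simp [heatOp, add_assoc]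
  · rw [← h2]
    refine Eq.trans ?_ (integral_prod _ h1).symm
    simp [heatOp, add_assoc]

theorem heatOp_mono {t : ℝ} {g h : Space d → ℝ} {x : Space d}
    (hg : Integrable (fun v => g (x + √t • v)) (stdGaussian (Space d)))
    (hh : Integrable (fun v => h (x + √t • v)) (stdGaussian (Space d)))
    (hgh : ∀ y, g y ≤ h y) : heatOp t g x ≤ heatOp t h x :=
  integral_mono hg hh fun _ => hgh _

/-- The universal majorant: the Gaussian density decays like `exp(-|v|²/2)`, which leaves room for
`exp(|v|²/4)`. -/
theorem integrable_exp_quarter_sq_norm (M : ℝ) :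
    Integrable (fun v : Space d => Real.exp (M + ‖v‖ ^ 2 / 4)) (stdGaussian (Space d)) := by
  rw [integrable_stdGaussian_iff]
  refine ((integrable_exp_neg_mul_sq_norm_add_inner (by norm_num : (0 : ℝ) < 1 / 4)
    (0 : Space d)).const_mul ((2 * Real.pi) ^ (-(d : ℝ) / 2) * Real.exp M)).congr
    (Eventually.of_forall fun v => ?_)
  simp only [heatKernel_one, inner_zero_left, add_zero]
  rw [mul_assoc, mul_assoc, ← Real.exp_add, ← Real.exp_add]
  ring_nf

/-- The smooth weight `(1 + |x - x₀|²)^p`. -/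
noncomputable def smoothWeight (x₀ : Space d) (p : ℝ) (x : Space d) : ℝ :=
  (1 + ‖x - x₀‖ ^ 2) ^ p

theorem continuous_smoothWeight (x₀ : Space d) (p : ℝ) : Continuous (smoothWeight x₀ p) := by
  unfold smoothWeight
  exact Continuous.rpow_const (by fun_prop) fun x => Or.inl (by positivity)

theorem one_le_smoothWeight (x₀ : Space d) {p : ℝ} (hp : 0 ≤ p) (x : Space d) :
    1 ≤ smoothWeight x₀ p x :=
  Real.one_le_rpow (by nlinarith [sq_nonneg ‖x - x₀‖]) hp

theorem smoothWeight_pos (x₀ : Space d) (p : ℝ) (x : Space d) : 0 < smoothWeight x₀ p x := by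
  unfold smoothWeight; positivity

theorem integrable_smoothWeight (x₀ : Space d) {p : ℝ} (hp : 0 ≤ p) (t : ℝ) (x : Space d) :
    Integrable (fun v => smoothWeight x₀ p (x + √t • v)) (stdGaussian (Space d)) := by
  refine (integrable_exp_quarter_sq_norm (2 * p * ‖x - x₀‖ + 4 * p ^ 2 * √t ^ 2)).mono'
    ((continuous_smoothWeight x₀ p).comp (by fun_prop)).aestronglyMeasurable
    (Eventually.of_forall fun v => ?_)
  rw [Real.norm_of_nonneg (smoothWeight_pos _ _ _).le, smoothWeight]
  have h1 : ‖x + √t • v - x₀‖ ≤ ‖x - x₀‖ + √t * ‖v‖ := by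
    have := norm_add_le (x - x₀) (√t • v)
    rw [norm_smul, Real.norm_of_nonneg (Real.sqrt_nonneg t)] at this
    rwa [show x + √t • v - x₀ = x - x₀ + √t • v by abel]
  have h2 : 1 + ‖x + √t • v - x₀‖ ^ 2 ≤ Real.exp (2 * ‖x + √t • v - x₀‖) := by
    have h3 := Real.add_one_le_exp ‖x + √t • v - x₀‖
    have h4 := norm_nonneg (x + √t • v - x₀)
    rw [two_mul, Real.exp_add]
    nlinarith
  refine (Real.rpow_le_rpow (by positivity) h2 hp).trans ?_
  rw [← Real.exp_mul]
  refine Real.exp_le_exp.2 ?_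
  nlinarith [sq_nonneg (‖v‖ / 2 - 2 * p * √t), mul_le_mul_of_nonneg_left h1 hp]

/-- The growth rate of the smooth weight under the heat semigroup. -/
noncomputable def weightRate (d : ℕ) (p : ℝ) : ℝ := 2 * p * d + p ^ 2

theorem weightRate_nonneg {p : ℝ} (hp : 0 ≤ p) : 0 ≤ weightRate d p := by
  unfold weightRate; positivity

/-- The inequality `1 + r ≤ e^r` bounds the weight at `x + √t v` by the weight at `x` times the
exponential of a quadratic polynomial in `v`, whose Gaussian expectation is explicit. The quadratic
coefficient `p t` must stay below `1/2`, hence the restriction to short times. -/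
theorem heatOp_smoothWeight_le_of_small (x₀ : Space d) {p t : ℝ} (hp : 0 ≤ p) (ht : 0 ≤ t)
    (hpt : p * t ≤ 1 / 4) (x : Space d) :
    heatOp t (smoothWeight x₀ p) x ≤ Real.exp (weightRate d p * t) * smoothWeight x₀ p x := by
  set a : Space d := (1 + ‖x - x₀‖ ^ 2)⁻¹ • (x - x₀) with ha
  have hpos : 0 < 1 + ‖x - x₀‖ ^ 2 := by positivity
  -- This is `r / (1 + r²) ≤ 1/2`; it keeps the linear term in the exponent bounded uniformly in
  -- `x`.
  have hna : ‖a‖ ^ 2 ≤ 1 / 4 := by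
    rw [ha, norm_smul, mul_pow, norm_inv, Real.norm_of_nonneg hpos.le, inv_pow,
      inv_mul_le_iff₀ (by positivity)]
    nlinarith [sq_nonneg (1 - ‖x - x₀‖ ^ 2)]
  have hb : 0 < 1 / 2 - p * t := by linarith
  have h1 : ∀ v : Space d, smoothWeight x₀ p (x + √t • v) ≤ smoothWeight x₀ p x *
      Real.exp (p * t * ‖v‖ ^ 2 + ⟪(2 * p * √t) • a, v⟫) := by
    intro v
    have h2 : 1 + ‖x + √t • v - x₀‖ ^ 2 ≤
        (1 + ‖x - x₀‖ ^ 2) * Real.exp (t * ‖v‖ ^ 2 + 2 * √t * ⟪a, v⟫) := by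
      have h3 := Real.add_one_le_exp (t * ‖v‖ ^ 2 + 2 * √t * ⟪a, v⟫)
      have h4 : (1 + ‖x - x₀‖ ^ 2) * ⟪a, v⟫ = ⟪x - x₀, v⟫ := by
        rw [ha, real_inner_smul_left, mul_inv_cancel_left₀ hpos.ne']
      rw [show x + √t • v - x₀ = (x - x₀) + √t • v by abel, norm_add_sq_real, norm_smul, mul_pow,
        Real.norm_eq_abs, sq_abs, Real.sq_sqrt ht, real_inner_smul_right]
      refine le_trans ?_ (mul_le_mul_of_nonneg_left h3 hpos.le)
      have h5 : (1 + ‖x - x₀‖ ^ 2) * (t * ‖v‖ ^ 2 + 2 * √t * ⟪a, v⟫ + 1) =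
        (1 + ‖x - x₀‖ ^ 2) * (t * ‖v‖ ^ 2 + 1) + 2 * √t * ((1 + ‖x - x₀‖ ^ 2) * ⟪a, v⟫) := by ring
      rw [h5, h4]
      nlinarith [mul_nonneg (sq_nonneg ‖x - x₀‖) (mul_nonneg ht (sq_nonneg ‖v‖))]
    refine (Real.rpow_le_rpow (by positivity) h2 hp).trans_eq ?_
    rw [Real.mul_rpow hpos.le (Real.exp_pos _).le, ← Real.exp_mul, real_inner_smul_left a v (2 * p * √t),
      show (t * ‖v‖ ^ 2 + 2 * √t * ⟪a, v⟫) * p = p * t * ‖v‖ ^ 2 + 2 * p * √t * ⟪a, v⟫ by ring]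
    rfl
  have h6 : ∀ v : Space d, heatKernel 1 v *
      (smoothWeight x₀ p x * Real.exp (p * t * ‖v‖ ^ 2 + ⟪(2 * p * √t) • a, v⟫)) =
      (2 * Real.pi) ^ (-(d : ℝ) / 2) * smoothWeight x₀ p x *
        Real.exp (-(1 / 2 - p * t) * ‖v‖ ^ 2 + ⟪(2 * p * √t) • a, v⟫) := by
    intro v
    rw [heatKernel_one, show -(1 / 2 - p * t) * ‖v‖ ^ 2 + ⟪(2 * p * √t) • a, v⟫ =
      -(1 / 2) * ‖v‖ ^ 2 + (p * t * ‖v‖ ^ 2 + ⟪(2 * p * √t) • a, v⟫) by ring, Real.exp_add (-(1 / 2) * ‖v‖ ^ 2)]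
    ring
  have hint : Integrable (fun v => smoothWeight x₀ p x *
      Real.exp (p * t * ‖v‖ ^ 2 + ⟪(2 * p * √t) • a, v⟫)) (stdGaussian (Space d)) := by
    rw [integrable_stdGaussian_iff]
    simp_rw [h6]
    exact (integrable_exp_neg_mul_sq_norm_add_inner hb _).const_mul _
  refine (integral_mono (integrable_smoothWeight x₀ hp t x) hint h1).trans ?_
  rw [integral_stdGaussian]
  simp_rw [h6]
  rw [integral_const_mul, integral_exp_neg_mul_sq_norm_add_inner hb]
  have h7 : (2 * Real.pi) ^ (-(d : ℝ) / 2) * (Real.pi / (1 / 2 - p * t)) ^ ((d : ℝ) / 2) ≤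
      Real.exp (2 * p * d * t) := by
    have e1 : Real.pi / (1 / 2 - p * t) = 2 * Real.pi * (1 / 2 / (1 / 2 - p * t)) := by
      field_simp
    rw [e1, Real.mul_rpow (x := 2 * Real.pi) (by positivity) (by positivity), ← mul_assoc,
      ← Real.rpow_add (by positivity), show -(d : ℝ) / 2 + d / 2 = 0 by ring, Real.rpow_zero,
      one_mul]
    have e2 : 1 / 2 / (1 / 2 - p * t) ≤ Real.exp (4 * (p * t)) := by
      rw [div_le_iff₀ hb]
      have := Real.add_one_le_exp (4 * (p * t))
      have hpt0 : 0 ≤ p * t := mul_nonneg hp ht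
      nlinarith
    refine (Real.rpow_le_rpow (by positivity) e2 (by positivity)).trans_eq ?_
    rw [← Real.exp_mul]
    ring_nf
  have h8 : Real.exp (‖(2 * p * √t) • a‖ ^ 2 / (4 * (1 / 2 - p * t))) ≤
      Real.exp (p ^ 2 * t) := by
    refine Real.exp_le_exp.2 ?_
    rw [norm_smul, mul_pow, Real.norm_eq_abs, sq_abs, mul_pow, mul_pow, Real.sq_sqrt ht,
      div_le_iff₀ (by linarith)]
    have hpt2 : 0 ≤ p ^ 2 * t := by positivity
    nlinarith [mul_le_mul_of_nonneg_left hna hpt2, mul_le_mul_of_nonneg_left hpt hpt2]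
  have h9 := mul_le_mul h7 h8 (Real.exp_pos _).le (Real.exp_pos _).le
  rw [← Real.exp_add, show 2 * p * d * t + p ^ 2 * t = weightRate d p * t by
    unfold weightRate; ring] at h9
  have h10 := mul_le_mul_of_nonneg_right h9 (smoothWeight_pos x₀ p x).le
  refine le_trans (le_of_eq ?_) h10
  ring

/-- The smooth weight is a supersolution of the heat equation with a linear source. -/
theorem heatOp_smoothWeight_le (x₀ : Space d) {p t : ℝ} (hp : 0 ≤ p) (ht : 0 ≤ t)
    (x : Space d) :
    heatOp t (smoothWeight x₀ p) x ≤ Real.exp (weightRate d p * t) * smoothWeight x₀ p x := by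
  -- Cut `[0,t]` into `n` steps short enough for the explicit estimate and compose them by the
  -- semigroup law. The bound is exponential in time, so the rates add up.
  obtain ⟨n, hn⟩ := exists_nat_gt (4 * (p * t))
  have hn0 : (0 : ℝ) < n := lt_of_le_of_lt (by positivity) hn
  have key : ∀ (τ : ℝ), 0 ≤ τ → p * τ ≤ 1 / 4 → ∀ (m : ℕ) (x : Space d),
      heatOp (m * τ) (smoothWeight x₀ p) x ≤
        Real.exp (weightRate d p * (m * τ)) * smoothWeight x₀ p x := by
    intro τ hτ hpτ m
    induction m with
    | zero => intro x; simp [heatOp]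
    | succ m ih =>
      intro x
      have hmτ : 0 ≤ (m : ℝ) * τ := by positivity
      obtain ⟨h1, h2⟩ := heatOp_heatOp hτ hmτ (continuous_smoothWeight x₀ p) (x := x)
        (integrable_smoothWeight x₀ hp _ x)
      have h3 : ((m + 1 : ℕ) : ℝ) * τ = τ + m * τ := by push_cast; ring
      rw [h3, ← h2]
      refine (heatOp_mono h1 ((integrable_smoothWeight x₀ hp τ x).const_mul _) ih).trans ?_
      have h4 : heatOp τ (fun y => Real.exp (weightRate d p * (m * τ)) * smoothWeight x₀ p y) x =
          Real.exp (weightRate d p * (m * τ)) * heatOp τ (smoothWeight x₀ p) x :=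
        integral_const_mul _ _
      rw [h4, mul_add, Real.exp_add, mul_comm (Real.exp (weightRate d p * τ)), mul_assoc]
      exact mul_le_mul_of_nonneg_left (heatOp_smoothWeight_le_of_small x₀ hp hτ hpτ x)
        (Real.exp_pos _).le
  have h := key (t / n) (by positivity) (by rw [← mul_div_assoc, div_le_iff₀ hn0]; linarith) n x
  rwa [mul_div_cancel₀ _ hn0.ne'] at h

end HeatSemigroup

/-! ### Duhamel integrals, damping and the weighted comparison estimate. -/

section Duhamel

variable {d : ℕ} {g : ℝ → Space d → ℝ} {M : ℝ}

/-- The Duhamel integral `∫₀ᵗ P_{t-s} g(s) ds`. -/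
noncomputable def duhamel (g : ℝ → Space d → ℝ) (t : ℝ) (x : Space d) : ℝ :=
  ∫ s in (0 : ℝ)..t, heatOp (t - s) (g s) x

theorem integrable_of_continuous_of_bound {α : Type*} [TopologicalSpace α] [MeasurableSpace α]
    [OpensMeasurableSpace α] {μ : Measure α} [IsFiniteMeasure μ] {h : α → ℝ}
    [SecondCountableTopologyEither α ℝ]
    (hc : Continuous h) (hb : ∀ y, |h y| ≤ M) : Integrable h μ :=
  Integrable.of_bound hc.aestronglyMeasurable M (Eventually.of_forall hb)

theorem abs_heatOp_le {h : Space d → ℝ} (hb : ∀ y, |h y| ≤ M) (t : ℝ) (x : Space d) :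
    |heatOp t h x| ≤ M := by
  simpa [heatOp] using norm_integral_le_of_norm_le_const (μ := stdGaussian (Space d)) (C := M)
    (f := fun v => h (x + √t • v)) (Eventually.of_forall fun v => hb (x + √t • v))

/-- In the Gaussian representation time enters only through `√τ`, which is continuous and equal to
`0` for `τ ≤ 0`. There is therefore no singularity at time zero, and no sign condition on `τ`. -/
theorem continuous_heatOp (hc : Continuous fun q : ℝ × Space d => g q.1 q.2)
    (hb : ∀ s y, |g s y| ≤ M) {X : Type*} [TopologicalSpace X] [FirstCountableTopology X]
    {τ σ : X → ℝ} {ξ : X → Space d} (hτ : Continuous τ) (hσ : Continuous σ) (hξ : Continuous ξ) :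
    Continuous fun q => heatOp (τ q) (g (σ q)) (ξ q) := by
  unfold heatOp
  have h1 : Continuous fun p : X × Space d => g (σ p.1) (ξ p.1 + √(τ p.1) • p.2) :=
    hc.comp ((hσ.comp continuous_fst).prodMk (by fun_prop))
  refine continuous_of_dominated (bound := fun _ => M) (fun q => ?_) (fun q => ?_)
    (integrable_const _) (Eventually.of_forall fun v => ?_)
  · exact (h1.comp (Continuous.prodMk_right q)).aestronglyMeasurable
  · exact Eventually.of_forall fun v => hb _ _
  · exact h1.comp (Continuous.prodMk_left v)

theorem continuous_duhamel (hc : Continuous fun q : ℝ × Space d => g q.1 q.2)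
    (hb : ∀ s y, |g s y| ≤ M) : Continuous fun q : ℝ × Space d => duhamel g q.1 q.2 := by
  unfold duhamel
  refine intervalIntegral.continuous_parametric_intervalIntegral_of_continuous ?_ continuous_fst
  exact continuous_heatOp hc hb (by fun_prop) continuous_snd (by fun_prop)

theorem abs_duhamel_le_mul (hb : ∀ s y, |g s y| ≤ M) {t : ℝ} (ht : 0 ≤ t) (x : Space d) :
    |duhamel g t x| ≤ M * t := by
  have h := intervalIntegral.norm_integral_le_of_norm_le_const (a := 0) (b := t)
    (f := fun s => heatOp (t - s) (g s) x) (C := M) fun s _ => abs_heatOp_le (hb s) _ _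
  rwa [sub_zero, abs_of_nonneg ht] at h

/-- Fubini and the semigroup law: propagating the time-`s` Duhamel integral to time `t` only
truncates the outer integral at `s`. -/
theorem heatOp_duhamel (hc : Continuous fun q : ℝ × Space d => g q.1 q.2)
    (hb : ∀ s y, |g s y| ≤ M) {s t : ℝ} (hs : 0 ≤ s) (hst : s ≤ t) (x : Space d) :
    heatOp (t - s) (duhamel g s) x = ∫ r in (0 : ℝ)..s, heatOp (t - r) (g r) x := by
  have hF : Continuous fun q : ℝ × Space d => heatOp (s - q.1) (g q.1) (x + √(t - s) • q.2) :=
    continuous_heatOp hc hb (by fun_prop) continuous_fst (by fun_prop)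
  have h1 : heatOp (t - s) (duhamel g s) x = ∫ v, (∫ r in (0 : ℝ)..s,
    heatOp (s - r) (g r) (x + √(t - s) • v)) ∂stdGaussian (Space d) := rfl
  rw [h1, ← intervalIntegral_integral_swap]
  · refine intervalIntegral.integral_congr fun r hr => ?_
    rw [uIcc_of_le hs] at hr
    have hgr : Continuous (g r) := hc.comp (Continuous.prodMk_right r)
    have h2 := (heatOp_heatOp (sub_nonneg.2 hst) (sub_nonneg.2 hr.2) hgr (x := x)
      (integrable_of_continuous_of_bound (hgr.comp (by fun_prop)) fun v => hb r _)).2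
    rw [sub_add_sub_cancel] at h2
    exact h2
  · have : IsFiniteMeasure ((volume : Measure ℝ).restrict (uIoc 0 s)) :=
      ⟨by simp [uIoc]⟩
    exact integrable_of_continuous_of_bound hF fun q => abs_heatOp_le (hb _) _ _

/-- The Duhamel integral solves the equation with an additional damping `L`. -/
theorem duhamel_eq_damped (hc : Continuous fun q : ℝ × Space d => g q.1 q.2)
    (hb : ∀ s y, |g s y| ≤ M) (L : ℝ) {t : ℝ} (ht : 0 ≤ t) (x : Space d) :
    duhamel g t x = ∫ s in (0 : ℝ)..t, Real.exp (-L * (t - s)) *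
      heatOp (t - s) (fun y => g s y + L * duhamel g s y) x := by
  have hq : Continuous fun s => heatOp (t - s) (g s) x :=
    continuous_heatOp hc hb (by fun_prop) continuous_id continuous_const
  -- With `t` and `x` fixed, the differentiated function equals `P_{t-s} w(s)` at `x` for `0 ≤ s ≤
  -- t`, where `w` is the Duhamel integral. Multiplying it by `e^(-L(t-s))` and integrating the
  -- derivative over `[0,t]` gives the damped formula.
  have hF : ∀ s, HasDerivAt (fun s => ∫ r in (0 : ℝ)..s, heatOp (t - r) (g r) x)
      (heatOp (t - s) (g s) x) s := fun s => hq.integral_hasStrictDerivAt 0 s |>.hasDerivAt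
  have hE : ∀ s, HasDerivAt (fun s => Real.exp (-L * (t - s)))
      (Real.exp (-L * (t - s)) * L) s := by
    intro s
    have := (((hasDerivAt_id s).const_sub t).const_mul (-L)).exp
    simpa using this
  have hFTC := intervalIntegral.integral_eq_sub_of_hasDerivAt (a := 0) (b := t)
    (fun s _ => (hE s).mul (hF s))
    (Continuous.intervalIntegrable (by
      have hFc : Continuous fun s => ∫ r in (0 : ℝ)..s, heatOp (t - r) (g r) x :=
        continuous_iff_continuousAt.2 fun s => (hF s).continuousAt
      fun_prop) _ _)
  simp only [Pi.mul_apply, sub_self, mul_zero, Real.exp_zero, one_mul,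
    intervalIntegral.integral_same, sub_zero] at hFTC
  rw [show duhamel g t x = ∫ r in (0 : ℝ)..t, heatOp (t - r) (g r) x from rfl, ← hFTC]
  refine intervalIntegral.integral_congr fun s hs => ?_
  rw [uIcc_of_le ht] at hs
  have hgs : Continuous (g s) := hc.comp (Continuous.prodMk_right s)
  have hds : Continuous (duhamel g s) := (continuous_duhamel hc hb).comp (Continuous.prodMk_right s)
  have h3 : heatOp (t - s) (fun y => g s y + L * duhamel g s y) x =
      heatOp (t - s) (g s) x + L * heatOp (t - s) (duhamel g s) x := by
    unfold heatOp
    rw [integral_add, integral_const_mul]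
    · exact integrable_of_continuous_of_bound (hgs.comp (by fun_prop)) fun v => hb s _
    · exact (integrable_of_continuous_of_bound (hds.comp (by fun_prop))
        fun v => abs_duhamel_le_mul hb hs.1 _).const_mul _
  rw [h3, heatOp_duhamel hc hb hs.1 hs.2]
  ring

theorem integral_exp_neg_mul_sub_le {a t : ℝ} (ha : 0 < a) :
    ∫ s in (0 : ℝ)..t, Real.exp (-a * (t - s)) ≤ 1 / a := by
  have hE : ∀ s, HasDerivAt (fun s => Real.exp (-a * (t - s)) / a)
      (Real.exp (-a * (t - s))) s := by
    intro s
    have := ((((hasDerivAt_id s).const_sub t).const_mul (-a)).exp).div_const a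
    simp only [id_eq, mul_neg, mul_one, neg_neg] at this
    rwa [mul_div_cancel_right₀ _ ha.ne'] at this
  rw [intervalIntegral.integral_eq_sub_of_hasDerivAt (fun s _ => hE s)
    (Continuous.intervalIntegrable (by fun_prop) _ _)]
  have : 0 < Real.exp (-a * (t - 0)) / a := by positivity
  simp only [sub_self, mul_zero, Real.exp_zero]
  linarith

/-- The exponential rate in the comparison estimate. -/
noncomputable def comparisonRate (d : ℕ) (p κ : ℝ) : ℝ := weightRate d p + 2 * κ + 2

theorem comparisonRate_pos {p κ : ℝ} (hp : 0 ≤ p) (hκ : 0 ≤ κ) : 0 < comparisonRate d p κ := by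
  have := weightRate_nonneg (d := d) hp
  unfold comparisonRate; positivity

/-- One step of the bootstrap. The damped source is `c w + (c - L) ζ` up to `δ`, and `c + |c - L| ≤
L + 2κ`, so it is at most `L + 2κ + 1` times the assumed bound. The damping and the choice of
`comparisonRate` leave a kernel `e^(-(L+2κ+2)(t-s))`, of integral at most `1 / (L+2κ+2)`. The
quotient is less than one, and `L` does not enter the exponential rate. -/
theorem abs_duhamel_le_improve (hc : Continuous fun q : ℝ × Space d => g q.1 q.2)
    (hb : ∀ s y, |g s y| ≤ M) {T : ℝ} {x₀ : Space d} {p κ L δ A : ℝ} (hp : 0 ≤ p) (hκ : 0 ≤ κ)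
    (hL : 0 ≤ L) (hδ : 0 < δ) {ζ : ℝ → Space d → ℝ}
    (hζ : ∀ t ∈ Icc 0 T, ∀ x, |ζ t x| ≤ δ * smoothWeight x₀ p x)
    (hg : ∀ t ∈ Icc 0 T, ∀ x, ∃ c ∈ Icc 0 (L + κ),
      |g t x + L * (duhamel g t x + ζ t x) - c * (duhamel g t x + ζ t x)| ≤ δ)
    (hA : 1 ≤ A) (hD : ∀ t ∈ Icc 0 T, ∀ x, |duhamel g t x| ≤
      A * (δ * Real.exp (comparisonRate d p κ * t) * smoothWeight x₀ p x)) :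
    ∀ t ∈ Icc 0 T, ∀ x, |duhamel g t x| ≤ (L + 2 * κ + 1) / (L + 2 * κ + 2) * A *
      (δ * Real.exp (comparisonRate d p κ * t) * smoothWeight x₀ p x) := by
  intro t ht x
  set lam := comparisonRate d p κ with hlam
  have hlam0 : 0 < lam := comparisonRate_pos hp hκ
  have hsrc : ∀ s ∈ Icc 0 t, ∀ y, |g s y + L * duhamel g s y| ≤
      (L + 2 * κ + 1) * A * δ * Real.exp (lam * s) * smoothWeight x₀ p y := by
    intro s hs y
    have hsT : s ∈ Icc 0 T := ⟨hs.1, hs.2.trans ht.2⟩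
    obtain ⟨c, hc, hcg⟩ := hg s hsT y
    have hφ := one_le_smoothWeight x₀ hp y
    set φ := smoothWeight x₀ p y
    have he : 1 ≤ Real.exp (lam * s) := Real.one_le_exp (mul_nonneg hlam0.le hs.1)
    set Φ := δ * Real.exp (lam * s) * φ with hΦ
    have hΦδ : δ ≤ Φ := by
      have := one_le_mul_of_one_le_of_one_le he hφ
      rw [hΦ, mul_assoc]
      nlinarith
    have hz : |ζ s y| ≤ Φ := (hζ s hsT y).trans (by
      rw [hΦ, mul_assoc]
      exact mul_le_mul_of_nonneg_left (le_mul_of_one_le_left (by positivity) he) hδ.le)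
    have hDs := hD s hsT y
    rw [← hΦ] at hDs
    have hΦA : Φ ≤ A * Φ := le_mul_of_one_le_left (hδ.le.trans hΦδ) hA
    have e1 : g s y + L * duhamel g s y =
        (g s y + L * (duhamel g s y + ζ s y) - c * (duhamel g s y + ζ s y)) +
          c * duhamel g s y + (c - L) * ζ s y := by ring
    have e2 : |g s y + L * duhamel g s y| ≤ δ + c * (A * Φ) + |c - L| * Φ := by
      rw [e1]
      refine (abs_add_le _ _).trans (add_le_add ((abs_add_le _ _).trans (add_le_add hcg ?_)) ?_)
      · rw [abs_mul, abs_of_nonneg hc.1]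
        exact mul_le_mul_of_nonneg_left hDs hc.1
      · rw [abs_mul]
        exact mul_le_mul_of_nonneg_left hz (abs_nonneg _)
    have hAΦ0 : 0 ≤ A * Φ := hδ.le.trans (hΦδ.trans hΦA)
    have e3 : c * (A * Φ) + |c - L| * Φ ≤ (L + 2 * κ) * (A * Φ) := by
      have e4 : c + |c - L| ≤ L + 2 * κ := by
        rcases abs_cases (c - L) with h | h <;> linarith [hc.2]
      calc c * (A * Φ) + |c - L| * Φ ≤ c * (A * Φ) + |c - L| * (A * Φ) := by gcongr
        _ = (c + |c - L|) * (A * Φ) := by ring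
        _ ≤ _ := mul_le_mul_of_nonneg_right e4 hAΦ0
    calc |g s y + L * duhamel g s y| ≤ (L + 2 * κ + 1) * (A * Φ) := by linarith
      _ = _ := by rw [hΦ]; ring
  have hbound : ∀ s ∈ Icc 0 t, |Real.exp (-L * (t - s)) *
      heatOp (t - s) (fun y => g s y + L * duhamel g s y) x| ≤
      (L + 2 * κ + 1) * A * (δ * Real.exp (lam * t) * smoothWeight x₀ p x) *
        Real.exp (-(L + 2 * κ + 2) * (t - s)) := by
    intro s hs
    have hgs : Continuous (g s) := hc.comp (Continuous.prodMk_right s)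
    have hds : Continuous (duhamel g s) :=
      (continuous_duhamel hc hb).comp (Continuous.prodMk_right s)
    have hint : Integrable (fun v => (L + 2 * κ + 1) * A * δ * Real.exp (lam * s) *
        smoothWeight x₀ p (x + √(t - s) • v)) (stdGaussian (Space d)) :=
      (integrable_smoothWeight x₀ hp _ x).const_mul _
    have h1 : |heatOp (t - s) (fun y => g s y + L * duhamel g s y) x| ≤
        (L + 2 * κ + 1) * A * δ * Real.exp (lam * s) *
          heatOp (t - s) (smoothWeight x₀ p) x := by
      refine (norm_integral_le_of_norm_le (f := fun v => g s (x + √(t - s) • v) +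
        L * duhamel g s (x + √(t - s) • v)) hint (Eventually.of_forall fun v => hsrc s hs _)).trans_eq ?_
      rw [integral_const_mul]
      rfl
    have h2 := heatOp_smoothWeight_le x₀ hp (sub_nonneg.2 hs.2) x
    rw [abs_mul, abs_of_pos (Real.exp_pos _)]
    have h3 : (0 : ℝ) ≤ (L + 2 * κ + 1) * A * δ * Real.exp (lam * s) := by positivity
    calc _ ≤ Real.exp (-L * (t - s)) * ((L + 2 * κ + 1) * A * δ * Real.exp (lam * s) *
          (Real.exp (weightRate d p * (t - s)) * smoothWeight x₀ p x)) := by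
          gcongr
          exact h1.trans (mul_le_mul_of_nonneg_left h2 h3)
      _ = (L + 2 * κ + 1) * A * δ * smoothWeight x₀ p x * (Real.exp (-L * (t - s)) *
          Real.exp (lam * s) * Real.exp (weightRate d p * (t - s))) := by ring
      _ = (L + 2 * κ + 1) * A * δ * smoothWeight x₀ p x * (Real.exp (lam * t) *
          Real.exp (-(L + 2 * κ + 2) * (t - s))) := by
          rw [← Real.exp_add, ← Real.exp_add, ← Real.exp_add, hlam, comparisonRate]
          ring_nf
      _ = _ := by ring
  rw [duhamel_eq_damped hc hb L ht.1 x]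
  refine (intervalIntegral.norm_integral_le_of_norm_le (f := fun s => Real.exp (-L * (t - s)) *
      heatOp (t - s) (fun y => g s y + L * duhamel g s y) x)
    (g := fun s => (L + 2 * κ + 1) * A * (δ * Real.exp (lam * t) * smoothWeight x₀ p x) *
        Real.exp (-(L + 2 * κ + 2) * (t - s))) ht.1
    (Eventually.of_forall fun s hs => hbound s ⟨hs.1.le, hs.2⟩)
    (Continuous.intervalIntegrable (by fun_prop) _ _)).trans ?_
  rw [intervalIntegral.integral_const_mul]
  have h0 := (smoothWeight_pos x₀ p x).le
  refine (mul_le_mul_of_nonneg_left (integral_exp_neg_mul_sub_le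
    (by positivity : 0 < L + 2 * κ + 2)) (by positivity)).trans_eq ?_
  ring

/-- Comparison with the weight: the Duhamel integral `w` of a source that is, up to an error `δ`,
of the form `-(L - c) (w + ζ)` with `0 ≤ c ≤ L + κ` is bounded in terms of `ζ` and `δ`,
uniformly in `L`. -/
theorem abs_duhamel_le (hc : Continuous fun q : ℝ × Space d => g q.1 q.2)
    (hb : ∀ s y, |g s y| ≤ M) {T : ℝ} {x₀ : Space d} {p κ L δ : ℝ} (hp : 0 ≤ p) (hκ : 0 ≤ κ)
    (hL : 0 ≤ L) (hδ : 0 < δ) {ζ : ℝ → Space d → ℝ}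
    (hζ : ∀ t ∈ Icc 0 T, ∀ x, |ζ t x| ≤ δ * smoothWeight x₀ p x)
    (hg : ∀ t ∈ Icc 0 T, ∀ x, ∃ c ∈ Icc 0 (L + κ),
      |g t x + L * (duhamel g t x + ζ t x) - c * (duhamel g t x + ζ t x)| ≤ δ)
    {t : ℝ} (ht : t ∈ Icc 0 T) (x : Space d) :
    |duhamel g t x| ≤ δ * Real.exp (comparisonRate d p κ * t) * smoothWeight x₀ p x := by
  set q := (L + 2 * κ + 1) / (L + 2 * κ + 2) with hq
  have hq0 : 0 ≤ q := by positivity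
  have hq1 : q < 1 := by rw [hq, div_lt_one (by positivity)]; linarith
  have hM : 0 ≤ M := (abs_nonneg _).trans (hb 0 0)
  -- The start is the crude bound `M T`, finite because the source is bounded; each step gains a
  -- factor `q` until the prefactor reaches `1`. The dependence on `M` disappears in the limit.
  have key : ∀ n : ℕ, ∀ t ∈ Icc 0 T, ∀ x, |duhamel g t x| ≤ max 1 (q ^ n * (M * T / δ)) *
      (δ * Real.exp (comparisonRate d p κ * t) * smoothWeight x₀ p x) := by
    intro n
    induction n with
    | zero =>
      intro t ht x
      have h1 : M * T / δ ≤ max 1 (q ^ 0 * (M * T / δ)) := by simp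
      have h2 : 1 ≤ Real.exp (comparisonRate d p κ * t) :=
        Real.one_le_exp (mul_nonneg (comparisonRate_pos hp hκ).le ht.1)
      have h3 := one_le_mul_of_one_le_of_one_le h2 (one_le_smoothWeight x₀ hp x)
      have h4 : δ ≤ δ * Real.exp (comparisonRate d p κ * t) * smoothWeight x₀ p x := by
        rw [mul_assoc]; exact le_mul_of_one_le_right hδ.le h3
      calc |duhamel g t x| ≤ M * t := abs_duhamel_le_mul hb ht.1 x
        _ ≤ M * T := mul_le_mul_of_nonneg_left ht.2 hM
        _ = M * T / δ * δ := by field_simp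
        _ ≤ _ := mul_le_mul h1 h4 hδ.le (by positivity)
    | succ n ih =>
      intro t ht x
      refine (abs_duhamel_le_improve hc hb hp hκ hL hδ hζ hg (le_max_left _ _) ih t ht x).trans ?_
      refine mul_le_mul_of_nonneg_right ?_
        (mul_nonneg (mul_nonneg hδ.le (Real.exp_pos _).le) (smoothWeight_pos x₀ p x).le)
      rw [← hq, mul_max_of_nonneg _ _ hq0, mul_one, ← mul_assoc, ← pow_succ']
      exact max_le_max hq1.le le_rfl
  have hlim : Tendsto (fun n : ℕ => max 1 (q ^ n * (M * T / δ)) *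
      (δ * Real.exp (comparisonRate d p κ * t) * smoothWeight x₀ p x)) atTop
      (𝓝 (max 1 (0 * (M * T / δ)) *
      (δ * Real.exp (comparisonRate d p κ * t) * smoothWeight x₀ p x))) :=
    (tendsto_const_nhds.max
      ((tendsto_pow_atTop_nhds_zero_of_lt_one hq0 hq1).mul_const _)).mul_const _
  have := ge_of_tendsto' hlim fun n => key n t ht x
  simpa using this

end Duhamel

/-! ### Mild solutions for Lipschitz drifts. -/

section Mild

variable {d : ℕ} {T : ℝ}

theorem abs_duhamel_le_integral {g : ℝ → Space d → ℝ} {b : ℝ → ℝ} (hbc : Continuous b) {t : ℝ}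
    (ht : 0 ≤ t) (hb : ∀ s ∈ Icc 0 t, ∀ y, |g s y| ≤ b s) (x : Space d) :
    |duhamel g t x| ≤ ∫ s in (0 : ℝ)..t, b s :=
  intervalIntegral.norm_integral_le_of_norm_le (f := fun s => heatOp (t - s) (g s) x) ht
    (Eventually.of_forall fun s hs => abs_heatOp_le (hb s ⟨hs.1.le, hs.2⟩) _ _)
    (hbc.intervalIntegrable _ _)

theorem duhamel_sub {g₁ g₂ : ℝ → Space d → ℝ} {M₁ M₂ : ℝ}
    (hc₁ : Continuous fun q : ℝ × Space d => g₁ q.1 q.2) (hb₁ : ∀ s y, |g₁ s y| ≤ M₁)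
    (hc₂ : Continuous fun q : ℝ × Space d => g₂ q.1 q.2) (hb₂ : ∀ s y, |g₂ s y| ≤ M₂)
    (t : ℝ) (x : Space d) :
    duhamel (fun s y => g₁ s y - g₂ s y) t x = duhamel g₁ t x - duhamel g₂ t x := by
  unfold duhamel
  rw [← intervalIntegral.integral_sub]
  · refine intervalIntegral.integral_congr fun s _ => ?_
    have h₁ : Continuous (g₁ s) := hc₁.comp (Continuous.prodMk_right s)
    have h₂ : Continuous (g₂ s) := hc₂.comp (Continuous.prodMk_right s)
    exact integral_sub (integrable_of_continuous_of_bound (h₁.comp (by fun_prop)) fun v => hb₁ s _)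
      (integrable_of_continuous_of_bound (h₂.comp (by fun_prop)) fun v => hb₂ s _)
  · exact (continuous_heatOp hc₁ hb₁ (by fun_prop) continuous_id
      continuous_const).intervalIntegrable _ _
  · exact (continuous_heatOp hc₂ hb₂ (by fun_prop) continuous_id
      continuous_const).intervalIntegrable _ _

/-- Dominated convergence for the Duhamel integral. -/
theorem tendsto_duhamel {g : ℕ → ℝ → Space d → ℝ} {g' : ℝ → Space d → ℝ} {t : ℝ} (ht : 0 ≤ t)
    {x : Space d} {H : Space d → ℝ} (hH : Integrable H (stdGaussian (Space d)))
    (hc : ∀ n, Continuous fun q : ℝ × Space d => g n q.1 q.2)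
    (hb : ∀ n, ∀ s ∈ Icc 0 t, ∀ v, |g n s (x + √(t - s) • v)| ≤ H v)
    (hlim : ∀ s ∈ Icc 0 t, ∀ y, Tendsto (fun n => g n s y) atTop (𝓝 (g' s y))) :
    Tendsto (fun n => duhamel (g n) t x) atTop (𝓝 (duhamel g' t x)) := by
  refine intervalIntegral.tendsto_integral_filter_of_dominated_convergence
    (fun _ => ∫ v, H v ∂stdGaussian (Space d)) (Eventually.of_forall fun n => ?_)
    (Eventually.of_forall fun n => Eventually.of_forall fun s hs => ?_)
    intervalIntegrable_const (Eventually.of_forall fun s hs => ?_)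
  · have h1 : Continuous fun q : ℝ × Space d => g n q.1 (x + √(t - q.1) • q.2) :=
      (hc n).comp
        (continuous_fst.prodMk (g := fun q : ℝ × Space d => x + √(t - q.1) • q.2) (by fun_prop))
    exact (h1.stronglyMeasurable.integral_prod_right'
      (ν := stdGaussian (Space d))).aestronglyMeasurable
  · rw [uIoc_of_le ht] at hs
    exact norm_integral_le_of_norm_le (f := fun v => g n s (x + √(t - s) • v)) hH
      (Eventually.of_forall fun v => hb n s ⟨hs.1.le, hs.2⟩ v)
  · rw [uIoc_of_le ht] at hs
    refine tendsto_integral_filter_of_dominated_convergence H (Eventually.of_forall fun n => ?_)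
      (Eventually.of_forall fun n => Eventually.of_forall fun v => hb n s ⟨hs.1.le, hs.2⟩ v) hH
      (Eventually.of_forall fun v => hlim s ⟨hs.1.le, hs.2⟩ _)
    exact ((hc n).comp (continuous_const.prodMk
      (g := fun v => x + √(t - s) • v) (by fun_prop))).aestronglyMeasurable

/-- The source term `f(u)`, with times clamped to `[0,T]`. -/
noncomputable def source (hT : 0 < T) (f : ℝ → ℝ) (u : SpaceTime T d → ℝ) (s : ℝ) (y : Space d) : ℝ :=
  f (u (projIcc 0 T hT.le s, y))

theorem continuous_source (hT : 0 < T) {f : ℝ → ℝ} (hf : Continuous f) {u : SpaceTime T d → ℝ}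
    (hu : Continuous u) : Continuous fun q : ℝ × Space d => source hT f u q.1 q.2 :=
  hf.comp (hu.comp (((continuous_projIcc (h := hT.le)).comp continuous_fst).prodMk continuous_snd))

theorem exists_abs_source_le (hT : 0 < T) {f : ℝ → ℝ} (hf : Continuous f)
    (u : SpaceTime T d →ᵇ ℝ) : ∃ M, ∀ s y, |source hT f u s y| ≤ M := by
  obtain ⟨M, hM⟩ := (isCompact_Icc (a := -‖u‖) (b := ‖u‖)).exists_bound_of_continuousOn
    hf.continuousOn
  exact ⟨M, fun s y => hM _ (abs_le.1 (u.norm_coe_le_norm _))⟩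

/-- The mild form of the equation. -/
noncomputable def IsMild (hT : 0 < T) (f : ℝ → ℝ) (z u : SpaceTime T d → ℝ) : Prop :=
  ∀ (t : Icc (0 : ℝ) T) (x : Space d), u (t, x) = duhamel (source hT f u) t x + z (t, x)

theorem exists_duhamel_source (hT : 0 < T) {f : ℝ → ℝ} (hf : Continuous f)
    (u : SpaceTime T d →ᵇ ℝ) :
    ∃ B : SpaceTime T d →ᵇ ℝ, ∀ p, B p = duhamel (source hT f u) p.1 p.2 := by
  obtain ⟨M, hM⟩ := exists_abs_source_le hT hf u
  have hM0 : 0 ≤ M := (abs_nonneg _).trans (hM 0 0)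
  refine ⟨BoundedContinuousFunction.ofNormedAddCommGroup
    (fun p : SpaceTime T d => duhamel (source hT f u) p.1 p.2) ?_ (M * T) fun p => ?_, fun p => rfl⟩
  · exact (continuous_duhamel (continuous_source hT hf u.continuous) hM).comp
      (f := fun p : SpaceTime T d => ((p.1 : ℝ), p.2)) (by fun_prop)
  · exact (abs_duhamel_le_mul hM p.1.2.1 _).trans (mul_le_mul_of_nonneg_left p.1.2.2 hM0)

theorem exists_expTime (T : ℝ) (d : ℕ) (a : ℝ) :
    ∃ B : SpaceTime T d →ᵇ ℝ, ∀ p, B p = Real.exp (a * p.1) := by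
  refine ⟨BoundedContinuousFunction.ofNormedAddCommGroup
    (fun p : SpaceTime T d => Real.exp (a * p.1)) (by fun_prop) (Real.exp (|a| * T)) fun p => ?_,
    fun p => rfl⟩
  rw [Real.norm_of_nonneg (Real.exp_pos _).le]
  exact Real.exp_le_exp.2 (mul_le_mul (le_abs_self a) p.1.2.2 p.1.2.1 (abs_nonneg a))

/-- Picard's theorem for a globally Lipschitz drift. -/
theorem exists_isMild_of_lipschitz (hT : 0 < T) {f : ℝ → ℝ} {L : NNReal} (hf : LipschitzWith L f)
    (z : SpaceTime T d →ᵇ ℝ) : ∃ u : SpaceTime T d →ᵇ ℝ, IsMild hT f z u := by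
  choose D hD using fun u : SpaceTime T d →ᵇ ℝ => exists_duhamel_source hT hf.continuous u
  set a : ℝ := 2 * L + 1 with ha
  have ha0 : 0 < a := by positivity
  obtain ⟨E, hE⟩ := exists_expTime T d a
  obtain ⟨E', hE'⟩ := exists_expTime T d (-a)
  -- Conjugating the Picard map by `e^(at)` gives it Lipschitz constant `L / a ≤ 1/2` for `a = 2L +
  -- 1`, whatever the length `T`. The solution is `e^(at)` times the fixed point.
  set Φ : (SpaceTime T d →ᵇ ℝ) → (SpaceTime T d →ᵇ ℝ) := fun v => E' * (D (E * v) + z) with hΦ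
  have hcontr : ContractingWith (1 / 2) Φ := by
    refine ⟨NNReal.coe_lt_coe.1 (by norm_num), LipschitzWith.of_dist_le_mul fun v w => ?_⟩
    refine (BoundedContinuousFunction.dist_le (by positivity)).2 fun p => ?_
    obtain ⟨M₁, hM₁⟩ := exists_abs_source_le hT hf.continuous (E * v)
    obtain ⟨M₂, hM₂⟩ := exists_abs_source_le hT hf.continuous (E * w)
    have h1 : |D (E * v) p - D (E * w) p| ≤
        ∫ s in (0 : ℝ)..p.1, L * dist v w * Real.exp (a * p.1) * Real.exp (-a * (p.1 - s)) := by
      rw [hD, hD, ← duhamel_sub (continuous_source hT hf.continuous (E * v).continuous) hM₁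
        (continuous_source hT hf.continuous (E * w).continuous) hM₂]
      refine abs_duhamel_le_integral (by fun_prop) p.1.2.1 (fun s hs y => ?_) _
      have hsT : s ∈ Icc 0 T := ⟨hs.1, hs.2.trans p.1.2.2⟩
      have h2 := hf.dist_le_mul ((E * v) (projIcc 0 T hT.le s, y))
        ((E * w) (projIcc 0 T hT.le s, y))
      refine h2.trans ?_
      rw [BoundedContinuousFunction.mul_apply, BoundedContinuousFunction.mul_apply,
        Real.dist_eq, ← mul_sub, abs_mul, hE, abs_of_pos (Real.exp_pos _)]
      have h3 : |v (projIcc 0 T hT.le s, y) - w (projIcc 0 T hT.le s, y)| ≤ dist v w :=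
        (BoundedContinuousFunction.dist_coe_le_dist (f := v) (g := w) _)
      have h4 : Real.exp (a * p.1) * Real.exp (-a * (p.1 - s)) = Real.exp (a * s) := by
        rw [← Real.exp_add]; ring_nf
      rw [mul_assoc _ (Real.exp _), h4, projIcc_of_mem hT.le hsT]
      rw [projIcc_of_mem hT.le hsT] at h3
      calc (L : ℝ) * (Real.exp (a * s) * _) ≤ L * (Real.exp (a * s) * dist v w) := by gcongr
        _ = _ := by ring
    rw [intervalIntegral.integral_const_mul] at h1
    have h5 := mul_le_mul_of_nonneg_left (integral_exp_neg_mul_sub_le (t := p.1) ha0)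
      (by positivity : 0 ≤ L * dist v w * Real.exp (a * p.1))
    have h6 : Real.exp (-a * p.1) * Real.exp (a * p.1) = 1 := by
      rw [← Real.exp_add]; simp
    simp only [hΦ, BoundedContinuousFunction.mul_apply, BoundedContinuousFunction.add_apply]
    rw [Real.dist_eq, ← mul_sub, add_sub_add_right_eq_sub, abs_mul, hE',
      abs_of_pos (Real.exp_pos _)]
    calc Real.exp (-a * p.1) * |D (E * v) p - D (E * w) p|
        ≤ Real.exp (-a * p.1) * (L * dist v w * Real.exp (a * p.1) * (1 / a)) :=
          mul_le_mul_of_nonneg_left (h1.trans h5) (Real.exp_pos _).le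
      _ = (Real.exp (-a * p.1) * Real.exp (a * p.1)) * (L / a * dist v w) := by ring
      _ ≤ _ := by
          rw [h6, one_mul]
          refine mul_le_mul_of_nonneg_right ?_ dist_nonneg
          rw [div_le_iff₀ ha0, ha]
          push_cast
          nlinarith [L.2]
  refine ⟨E * hcontr.fixedPoint Φ, fun t x => ?_⟩
  have hfix : Φ (hcontr.fixedPoint Φ) = hcontr.fixedPoint Φ := hcontr.fixedPoint_isFixedPt
  set v := hcontr.fixedPoint Φ
  have h7 : E * E' = 1 := by
    ext p
    rw [BoundedContinuousFunction.mul_apply, hE, hE', ← Real.exp_add]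
    simp
  have h8 : E * v = D (E * v) + z := by
    conv_lhs => rw [← hfix]
    simp only [hΦ]
    rw [← mul_assoc, h7, one_mul]
  have h9 := congrArg (fun w : SpaceTime T d →ᵇ ℝ => w (t, x)) h8
  simpa only [BoundedContinuousFunction.add_apply, hD] using h9

/-- One-sided Lipschitz continuity. -/
noncomputable def OneSided (f : ℝ → ℝ) (κ : ℝ) : Prop := ∀ u₁ u₂ : ℝ, u₁ < u₂ → f u₂ - f u₁ ≤ κ * (u₂ - u₁)

/-- Difference quotients of `f` lie in `[-L, κ]`: the lower end comes from the Lipschitz bound, the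
upper end from the one-sided one. The shift by `L` makes them nonnegative. -/
theorem OneSided.exists_slope {f : ℝ → ℝ} {κ : ℝ} {L : NNReal} (h : OneSided f κ) (hκ : 0 ≤ κ)
    (hf : LipschitzWith L f) (a b : ℝ) :
    ∃ c ∈ Icc 0 (L + κ), f a - f b + L * (a - b) = c * (a - b) := by
  have key : ∀ a b : ℝ, a < b →
      ∃ c ∈ Icc 0 (L + κ), f b - f a + L * (b - a) = c * (b - a) := by
    intro a b hab
    have hpos : 0 < b - a := sub_pos.2 hab
    have h1 := h a b hab
    have h2 := (abs_le.1 (hf.dist_le_mul b a)).1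
    rw [Real.dist_eq, abs_of_pos hpos] at h2
    refine ⟨(f b - f a + L * (b - a)) / (b - a), ⟨div_nonneg (by linarith) hpos.le, ?_⟩, ?_⟩
    · rw [div_le_iff₀ hpos]; linarith
    · rw [div_mul_cancel₀ _ hpos.ne']
  rcases lt_trichotomy a b with hab | rfl | hab
  · obtain ⟨c, hc, h1⟩ := key a b hab
    exact ⟨c, hc, by linarith⟩
  · exact ⟨0, ⟨le_rfl, by positivity⟩, by ring⟩
  · exact key b a hab

/-- Comparison of a mild solution for a Lipschitz drift with a mild solution for a nearby drift. -/
theorem IsMild.abs_sub_le_of_lipschitz (hT : 0 < T) {f f₂ : ℝ → ℝ} {κ : ℝ} {L : NNReal}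
    (h : OneSided f κ) (hκ : 0 ≤ κ) (hf : LipschitzWith L f) (hf₂ : Continuous f₂)
    {z₁ z₂ u₁ u₂ : SpaceTime T d →ᵇ ℝ} (h₁ : IsMild hT f z₁ u₁) (h₂ : IsMild hT f₂ z₂ u₂)
    {x₀ : Space d} {p δ : ℝ} (hp : 0 ≤ p) (hδ : 0 < δ) (hff : ∀ q, |f₂ (u₂ q) - f (u₂ q)| ≤ δ)
    (hz : ∀ q, |z₁ q - z₂ q| ≤ δ * smoothWeight x₀ p q.2) (q : SpaceTime T d) :
    |u₁ q - u₂ q| ≤ 2 * δ * Real.exp (comparisonRate d p κ * T) * smoothWeight x₀ p q.2 := by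
  obtain ⟨M₁, hM₁⟩ := exists_abs_source_le hT hf.continuous u₁
  obtain ⟨M₂, hM₂⟩ := exists_abs_source_le hT hf₂ u₂
  have hc₁ := continuous_source hT hf.continuous u₁.continuous
  have hc₂ := continuous_source hT hf₂ u₂.continuous
  set g : ℝ → Space d → ℝ := fun s y => source hT f u₁ s y - source hT f₂ u₂ s y with hg
  set ζ : ℝ → Space d → ℝ := fun s y => z₁ (projIcc 0 T hT.le s, y) - z₂ (projIcc 0 T hT.le s, y)
    with hζ
  -- Subtracting the two equations. The source difference then has slope form in `u₁ - u₂` for the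
  -- drift `f`, with the error `f₂(u₂) - f(u₂)`.
  have hD : ∀ t (ht : t ∈ Icc 0 T) x, duhamel g t x + ζ t x = u₁ (⟨t, ht⟩, x) - u₂ (⟨t, ht⟩, x) := by
    intro t ht x
    rw [hg, duhamel_sub hc₁ hM₁ hc₂ hM₂, h₁ ⟨t, ht⟩ x, h₂ ⟨t, ht⟩ x, hζ]
    simp only [projIcc_of_mem hT.le ht]
    ring
  have hζb : ∀ t ∈ Icc 0 T, ∀ x, |ζ t x| ≤ δ * smoothWeight x₀ p x := fun t _ x => hz _
  have hmain := abs_duhamel_le (g := g) (M := M₁ + M₂) (T := T) (x₀ := x₀) (κ := κ) (L := L)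
    (ζ := ζ) (hc₁.sub hc₂)
    (fun s y => (abs_sub _ _).trans (add_le_add (hM₁ s y) (hM₂ s y))) hp hκ L.2 hδ hζb
    (fun t ht x => by
      obtain ⟨c, hc, hcs⟩ := h.exists_slope hκ hf (u₁ (⟨t, ht⟩, x)) (u₂ (⟨t, ht⟩, x))
      refine ⟨c, hc, ?_⟩
      rw [hD t ht x, hg]
      simp only [source, projIcc_of_mem hT.le ht]
      refine le_trans (le_of_eq ?_) (hff (⟨t, ht⟩, x))
      rw [← abs_neg]
      congr 1
      linarith) q.1.2 q.2
  have hq := hD q.1 q.1.2 q.2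
  have hζq := hζb q.1 q.1.2 q.2
  have hw := (smoothWeight_pos x₀ p q.2).le
  have hle : Real.exp (comparisonRate d p κ * q.1) ≤ Real.exp (comparisonRate d p κ * T) :=
    Real.exp_le_exp.2 (mul_le_mul_of_nonneg_left q.1.2.2 (comparisonRate_pos hp hκ).le)
  have h1e : 1 ≤ Real.exp (comparisonRate d p κ * T) :=
    Real.one_le_exp (mul_nonneg (comparisonRate_pos hp hκ).le hT.le)
  have e : u₁ q - u₂ q = duhamel g q.1 q.2 + ζ q.1 q.2 := hq.symm
  rw [e]
  calc _ ≤ |duhamel g q.1 q.2| + |ζ q.1 q.2| := abs_add_le _ _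
    _ ≤ δ * Real.exp (comparisonRate d p κ * T) * smoothWeight x₀ p q.2 +
        δ * Real.exp (comparisonRate d p κ * T) * smoothWeight x₀ p q.2 := by
      refine add_le_add (hmain.trans ?_) (hζq.trans ?_)
      · gcongr
      · refine mul_le_mul_of_nonneg_right ?_ hw
        exact le_mul_of_one_le_right hδ.le h1e
    _ = _ := by ring

end Mild

/-! ### Bounded solutions for one-sided Lipschitz drifts. -/

section Existence

variable {d : ℕ} {T : ℝ}

/-- A continuous function satisfying a one-sided Lipschitz condition can be approximated,
uniformly on compact sets, by globally Lipschitz functions satisfying the same condition. -/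
theorem OneSided.exists_lipschitz_approx {f : ℝ → ℝ} {κ : ℝ} (h : OneSided f κ) (hκ : 0 ≤ κ)
    (hf : Continuous f) {R : ℝ} (hR : 0 ≤ R) {ε : ℝ} (hε : 0 < ε) :
    ∃ (F : ℝ → ℝ) (L : NNReal), LipschitzWith L F ∧ OneSided F κ ∧
      ∀ r ∈ Icc (-R) R, |F r - f r| ≤ ε := by
  have hRR : -R ≤ R := by linarith
  -- Clamp the argument, then average over a short window. Clamping is monotone and 1-Lipschitz, so
  -- with `κ ≥ 0` it preserves the one-sided condition, and averaging preserves it too. The average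
  -- of a function bounded by `M` over a window of length `k` is Lipschitz with constant `2M/k`.
  set g : ℝ → ℝ := fun r => f (projIcc (-R) R hRR r) with hg
  have hgu : UniformContinuous g := by
    have h1 : UniformContinuous fun r : Icc (-R) R => f r :=
      CompactSpace.uniformContinuous_of_continuous (by fun_prop)
    exact h1.comp (LipschitzWith.projIcc hRR).uniformContinuous
  have hgc : Continuous g := hgu.continuous
  have hgi : ∀ a b, IntervalIntegrable g volume a b := fun a b => hgc.intervalIntegrable a b
  obtain ⟨M, hM⟩ := (isCompact_Icc (a := -R) (b := R)).exists_bound_of_continuousOn hf.continuousOn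
  have hgM : ∀ r, ‖g r‖ ≤ M := fun r => hM _ (projIcc (-R) R hRR r).2
  have hM0 : 0 ≤ M := (norm_nonneg _).trans (hgM 0)
  have hgs : ∀ a b, a ≤ b → g b - g a ≤ κ * (b - a) := by
    intro a b hab
    have hm : (projIcc (-R) R hRR a : ℝ) ≤ projIcc (-R) R hRR b := monotone_projIcc hRR hab
    have h1 : (projIcc (-R) R hRR b : ℝ) - projIcc (-R) R hRR a ≤ b - a := by
      have := (LipschitzWith.projIcc hRR).dist_le_mul b a
      rw [Subtype.dist_eq, Real.dist_eq, Real.dist_eq, abs_of_nonneg (sub_nonneg.2 hm),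
        abs_of_nonneg (sub_nonneg.2 hab)] at this
      simpa using this
    rcases hm.eq_or_lt with he | hl
    · simp only [hg, he, sub_self]
      exact mul_nonneg hκ (sub_nonneg.2 hab)
    · exact (h _ _ hl).trans (mul_le_mul_of_nonneg_left h1 hκ)
  obtain ⟨η, hη, hgη⟩ := Metric.uniformContinuous_iff.1 hgu ε hε
  set k := η / 2 with hk
  have hk0 : 0 < k := by positivity
  have hshift : ∀ r, ∫ s in r..(r + k), g s = ∫ s in (0 : ℝ)..k, g (r + s) := by
    intro r
    rw [intervalIntegral.integral_comp_add_left (fun s => g s) r, add_zero]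
  have hgi' : ∀ r, IntervalIntegrable (fun s => g (r + s)) volume 0 k := fun r =>
    (hgc.comp (by fun_prop)).intervalIntegrable _ _
  refine ⟨fun r => k⁻¹ * ∫ s in r..(r + k), g s, Real.toNNReal (k⁻¹ * (M + M)),
    LipschitzWith.of_dist_le_mul fun a b => ?_, fun a b hab => ?_, fun r hr => ?_⟩
  · rw [Real.coe_toNNReal _ (by positivity), Real.dist_eq, Real.dist_eq, ← mul_sub, abs_mul,
      abs_of_pos (inv_pos.2 hk0), mul_assoc]
    refine mul_le_mul_of_nonneg_left ?_ (inv_pos.2 hk0).le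
    rw [intervalIntegral.integral_interval_sub_interval_comm (hgi _ _) (hgi _ _) (hgi _ _)]
    have h1 := intervalIntegral.norm_integral_le_of_norm_le_const (a := a) (b := b) (f := g)
      fun r _ => hgM r
    have h2 := intervalIntegral.norm_integral_le_of_norm_le_const (a := a + k) (b := b + k) (f := g)
      fun r _ => hgM r
    rw [add_sub_add_right_eq_sub] at h2
    rw [abs_sub_comm a b, add_mul]
    exact (abs_sub _ _).trans (add_le_add h1 h2)
  · simp only
    rw [hshift, hshift, ← mul_sub, ← intervalIntegral.integral_sub (hgi' _) (hgi' _),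
      inv_mul_le_iff₀ hk0]
    have h1 := intervalIntegral.integral_mono_on hk0.le ((hgi' b).sub (hgi' a))
      (intervalIntegrable_const (c := κ * (b - a)))
      fun s _ => (hgs (a + s) (b + s) (by linarith)).trans_eq (by ring)
    rw [intervalIntegral.integral_const, sub_zero, smul_eq_mul] at h1
    exact h1
  · have h1 : f r = k⁻¹ * ∫ s in (0 : ℝ)..k, g r := by
      rw [intervalIntegral.integral_const, sub_zero, smul_eq_mul, inv_mul_cancel_left₀ hk0.ne', hg]
      simp only [projIcc_of_mem hRR hr]
    simp only
    rw [h1, hshift, ← mul_sub, ← intervalIntegral.integral_sub (hgi' _) intervalIntegrable_const,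
      abs_mul, abs_of_pos (inv_pos.2 hk0), inv_mul_le_iff₀ hk0]
    have h2 := intervalIntegral.norm_integral_le_of_norm_le_const (a := 0) (b := k)
      (f := fun s => g (r + s) - g r) (C := ε) fun s hs => by
        rw [uIoc_of_le hk0.le] at hs
        refine (hgη (a := r + s) (b := r) ?_).le
        rw [Real.dist_eq, add_sub_cancel_left, abs_of_pos hs.1]
        linarith [hs.2]
    rw [sub_zero, abs_of_pos hk0] at h2
    linarith [h2, Real.norm_eq_abs (∫ s in (0 : ℝ)..k, (g (r + s) - g r))]

theorem smoothWeight_zero (x₀ x : Space d) : smoothWeight x₀ 0 x = 1 := Real.rpow_zero _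

theorem isMild_zero (hT : 0 < T) :
    IsMild hT (fun _ => 0) (0 : SpaceTime T d →ᵇ ℝ) (0 : SpaceTime T d →ᵇ ℝ) := by
  intro t x
  simp [duhamel, heatOp, source]

/-- Existence of bounded solutions. -/
theorem OneSided.exists_isMild (hT : 0 < T) {f : ℝ → ℝ} {κ : ℝ} (h : OneSided f κ) (hκ : 0 ≤ κ)
    (hf : Continuous f) (z : SpaceTime T d →ᵇ ℝ) : ∃ u : SpaceTime T d →ᵇ ℝ, IsMild hT f z u := by
  set B := Real.exp (comparisonRate d 0 κ * T) with hB
  have hB0 : 0 < B := Real.exp_pos _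
  -- The `1` absorbs the approximation error at `0`. Comparison with the zero solution of the zero
  -- drift then bounds every approximate solution by `R = 2δB`. This is not circular: that bound
  -- uses only `κ` and the value of the approximate drift at `0`.
  set δ := ‖z‖ + |f 0| + 1 with hδ
  have hδ0 : 0 < δ := by positivity
  set R := 2 * δ * B with hR
  have hR0 : 0 ≤ R := by positivity
  choose F L hFL hFs hFf using fun n : ℕ =>
    h.exists_lipschitz_approx hκ hf hR0 (Nat.one_div_pos_of_nat (α := ℝ) (n := n))
  choose u hu using fun n => exists_isMild_of_lipschitz hT (hFL n) z
  have hinv : ∀ n : ℕ, 1 / ((n : ℝ) + 1) ≤ 1 := fun n => by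
    rw [div_le_one (by positivity)]; linarith [Nat.cast_nonneg (α := ℝ) n]
  have hub : ∀ n q, |u n q| ≤ R := by
    intro n q
    have h1 := IsMild.abs_sub_le_of_lipschitz hT (hFs n) hκ (hFL n) (f₂ := fun _ => 0)
      continuous_const (hu n) (isMild_zero hT) (x₀ := 0) le_rfl hδ0 (fun q => ?_) (fun q => ?_) q
    · simpa [smoothWeight_zero] using h1
    · have h2 := hFf n 0 ⟨by linarith, hR0⟩
      have h3 := abs_sub_abs_le_abs_sub (F n 0) (f 0)
      simp only [BoundedContinuousFunction.coe_zero, Pi.zero_apply, zero_sub, abs_neg]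
      linarith [hinv n, norm_nonneg z]
    · have h2 := z.norm_coe_le_norm q
      rw [Real.norm_eq_abs] at h2
      simp only [BoundedContinuousFunction.coe_zero, Pi.zero_apply, sub_zero, smoothWeight_zero,
        mul_one]
      linarith [abs_nonneg (f 0)]
  -- On `[-R, R]`, where the solutions live, the two drifts differ by at most `2/(n+1)`. Since the
  -- comparison constant ignores their Lipschitz constants, the sequence is Cauchy.
  have hdist : ∀ n m : ℕ, n ≤ m → dist (u n) (u m) ≤ 4 * B * (1 / ((n : ℝ) + 1)) := by
    intro n m hnm
    refine (BoundedContinuousFunction.dist_le (by positivity)).2 fun q => ?_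
    have hpos : (0 : ℝ) < 2 * (1 / ((n : ℝ) + 1)) := by positivity
    have h1 := IsMild.abs_sub_le_of_lipschitz hT (hFs n) hκ (hFL n) (hFL m).continuous (hu n) (hu m)
      (x₀ := 0) le_rfl hpos (fun q => ?_) (fun q => ?_) q
    · rw [smoothWeight_zero, mul_one] at h1
      rw [Real.dist_eq]
      linarith
    · have hm := abs_le.1 (hub m q)
      have h2 := hFf n _ hm
      have h3 := hFf m _ hm
      have h4 : 1 / ((m : ℝ) + 1) ≤ 1 / ((n : ℝ) + 1) := by gcongr
      have h5 := abs_sub_le (F m (u m q)) (f (u m q)) (F n (u m q))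
      rw [abs_sub_comm (f (u m q))] at h5
      linarith
    · rw [sub_self, abs_zero, smoothWeight_zero]
      linarith
  have hlim0 : Tendsto (fun n : ℕ => 4 * B * (1 / ((n : ℝ) + 1))) atTop (𝓝 0) := by
    simpa using (tendsto_one_div_add_atTop_nhds_zero_nat (𝕜 := ℝ)).const_mul (4 * B)
  have hcau : CauchySeq u := cauchySeq_of_le_tendsto_0' _ hdist hlim0
  obtain ⟨v, hv⟩ := cauchySeq_tendsto_of_complete hcau
  have hpt : ∀ q, Tendsto (fun n => u n q) atTop (𝓝 (v q)) := fun q =>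
    (BoundedContinuousFunction.tendsto_iff_tendstoUniformly.1 hv).tendsto_at q
  refine ⟨v, fun t x => ?_⟩
  have h1 : Tendsto (fun n => u n (t, x)) atTop (𝓝 (duhamel (source hT f v) t x + z (t, x))) := by
    simp_rw [hu _ t x]
    refine Tendsto.add_const _ ?_
    obtain ⟨M, hM⟩ := (isCompact_Icc (a := -R) (b := R)).exists_bound_of_continuousOn
      hf.continuousOn
    refine tendsto_duhamel t.2.1 (integrable_const (M + 1))
      (fun n => continuous_source hT (hFL n).continuous (u n).continuous) (fun n s _ v => ?_)
      fun s _ y => ?_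
    · have hm := abs_le.1 (hub n (projIcc 0 T hT.le s, x + √(t - s) • v))
      have h2 := hFf n _ hm
      have h3 := hM _ hm
      rw [Real.norm_eq_abs] at h3
      have h4 := abs_sub_abs_le_abs_sub (F n (u n (projIcc 0 T hT.le s, x + √(t - s) • v)))
        (f (u n (projIcc 0 T hT.le s, x + √(t - s) • v)))
      simp only [source]
      linarith [hinv n]
    · simp only [source]
      have h2 := (hf.tendsto _).comp (hpt (projIcc 0 T hT.le s, y))
      have h3 : Tendsto (fun n => F n (u n (projIcc 0 T hT.le s, y)) -
          f (u n (projIcc 0 T hT.le s, y))) atTop (𝓝 0) :=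
        squeeze_zero_norm (fun n => hFf n _ (abs_le.1 (hub n _)))
          tendsto_one_div_add_atTop_nhds_zero_nat
      simpa using h3.add h2
  exact tendsto_nhds_unique (hpt _) h1

/-- Comparison of a bounded mild solution with a bounded mild solution for a nearby drift. -/
theorem IsMild.abs_sub_le (hT : 0 < T) {f f₂ : ℝ → ℝ} {κ : ℝ} (h : OneSided f κ) (hκ : 0 ≤ κ)
    (hf : Continuous f) (hf₂ : Continuous f₂) {z₁ z₂ u₁ u₂ : SpaceTime T d →ᵇ ℝ}
    (h₁ : IsMild hT f z₁ u₁) (h₂ : IsMild hT f₂ z₂ u₂) {x₀ : Space d} {p δ : ℝ} (hp : 0 ≤ p)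
    (hδ : 0 ≤ δ) (hff : ∀ q, |f₂ (u₂ q) - f (u₂ q)| ≤ δ)
    (hz : ∀ q, |z₁ q - z₂ q| ≤ δ * smoothWeight x₀ p q.2) (q : SpaceTime T d) :
    |u₁ q - u₂ q| ≤ 2 * δ * Real.exp (comparisonRate d p κ * T) * smoothWeight x₀ p q.2 := by
  set B := Real.exp (comparisonRate d p κ * T)
  set B₀ := Real.exp (comparisonRate d 0 κ * T)
  set φ := smoothWeight x₀ p q.2
  set R := max ‖u₁‖ ‖u₂‖ with hR
  have hR0 : 0 ≤ R := (norm_nonneg u₁).trans (le_max_left _ _)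
  -- Pass through a solution `w` with datum `z₁` and a Lipschitz drift within `ε` of `f` on the
  -- range of both solutions: `w - u₁` is compared with the constant weight, `w - u₂` with the given
  -- one.
  have key : ∀ ε : ℝ, 0 < ε → |u₁ q - u₂ q| ≤ 2 * ε * B₀ + 2 * (δ + ε) * B * φ := by
    intro ε hε
    obtain ⟨F, L, hFL, hFs, hFf⟩ := h.exists_lipschitz_approx hκ hf hR0 hε
    obtain ⟨w, hw⟩ := exists_isMild_of_lipschitz hT hFL z₁
    have hi₁ : ∀ q, |f (u₁ q) - F (u₁ q)| ≤ ε := fun q => by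
      rw [abs_sub_comm]
      exact hFf _ (abs_le.1 ((u₁.norm_coe_le_norm q).trans (le_max_left _ _)))
    have hi₂ : ∀ q, |f (u₂ q) - F (u₂ q)| ≤ ε := fun q => by
      rw [abs_sub_comm]
      exact hFf _ (abs_le.1 ((u₂.norm_coe_le_norm q).trans (le_max_right _ _)))
    have e1 := hw.abs_sub_le_of_lipschitz hT hFs hκ hFL hf h₁ (x₀ := 0) le_rfl hε hi₁
      (fun q => by rw [sub_self, abs_zero, smoothWeight_zero]; linarith) q
    have e2 := hw.abs_sub_le_of_lipschitz hT hFs hκ hFL hf₂ h₂ (x₀ := x₀) hp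
      (by linarith : 0 < δ + ε)
      (fun q => (_root_.abs_sub_le _ (f (u₂ q)) _).trans (add_le_add (hff q) (hi₂ q)))
      (fun q => (hz q).trans (mul_le_mul_of_nonneg_right (by linarith)
        (smoothWeight_pos x₀ p q.2).le)) q
    rw [smoothWeight_zero, mul_one, abs_sub_comm] at e1
    exact (_root_.abs_sub_le _ (w q) _).trans (add_le_add e1 e2)
  have hlim : Tendsto (fun ε : ℝ => 2 * ε * B₀ + 2 * (δ + ε) * B * φ) (𝓝[>] 0)
      (𝓝 (2 * 0 * B₀ + 2 * (δ + 0) * B * φ)) :=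
    (Continuous.tendsto (by fun_prop) 0).mono_left nhdsWithin_le_nhds
  have := ge_of_tendsto hlim (eventually_nhdsWithin_of_forall key)
  simpa using this

theorem IsMild.unique (hT : 0 < T) {f : ℝ → ℝ} {κ : ℝ} (h : OneSided f κ) (hκ : 0 ≤ κ)
    (hf : Continuous f) {z u₁ u₂ : SpaceTime T d →ᵇ ℝ} (h₁ : IsMild hT f z u₁)
    (h₂ : IsMild hT f z u₂) : u₁ = u₂ := by
  ext q
  have := IsMild.abs_sub_le hT h hκ hf hf h₁ h₂ (x₀ := 0) le_rfl le_rfl (fun q => by simp)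
    (fun q => by simp) q
  simp only [mul_zero, zero_mul] at this
  exact sub_eq_zero.1 (abs_nonpos_iff.1 this)

/-- If the source has a Gaussian majorant, then the space-time integral converges absolutely. -/
theorem integrable_duhamelIntegrand (hT : 0 < T) {f : ℝ → ℝ} (hf : Continuous f)
    {u : SpaceTime T d → ℝ} (hu : Continuous u) {t : ℝ} {x : Space d}
    {H : Space d → ℝ} (hH : Integrable H (stdGaussian (Space d)))
    (hb : ∀ s ∈ Icc 0 t, ∀ v, |source hT f u s (x + √(t - s) • v)| ≤ H v) :
    Integrable (fun p : ℝ × Space d => duhamelIntegrand hT f u t x p.1 p.2)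
      ((volume.restrict (Ioc (0 : ℝ) t)).prod volume) := by
  have hc := continuous_source hT hf hu
  have hmeas : Measurable fun p : ℝ × Space d => duhamelIntegrand hT f u t x p.1 p.2 :=
    (measurable_heatKernel.comp (by fun_prop : Measurable fun p : ℝ × Space d =>
      (t - p.1, x - p.2))).mul hc.measurable
  -- The endpoint `s = t` is discarded because the kernel formula at time zero is not the identity
  -- operator.
  have hae : ∀ᵐ s ∂volume.restrict (Ioc (0 : ℝ) t), s ∈ Ioo 0 t := by
    rw [← restrict_Ioo_eq_restrict_Ioc]
    exact ae_restrict_mem measurableSet_Ioo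
  have hslice : ∀ s ∈ Ioo 0 t,
      Integrable (fun v => source hT f u s (x + √(t - s) • v)) (stdGaussian (Space d)) := by
    intro s hs
    refine hH.mono' ?_ (Eventually.of_forall fun v => hb s ⟨hs.1.le, hs.2.le⟩ v)
    have h1 : Continuous (source hT f u s) := hc.comp (Continuous.prodMk_right s)
    exact (h1.comp (by fun_prop : Continuous fun v => x + √(t - s) • v)).aestronglyMeasurable
  rw [integrable_prod_iff hmeas.aestronglyMeasurable]
  constructor
  · filter_upwards [hae] with s hs
    exact (integrable_heatKernel_mul_iff (sub_pos.2 hs.2) x (source hT f u s)).2 (hslice s hs)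
  · refine Integrable.of_bound (C := ∫ v, H v ∂stdGaussian (Space d))
      (hmeas.norm.stronglyMeasurable.integral_prod_right').aestronglyMeasurable ?_
    filter_upwards [hae] with s hs
    have h0 : 0 < t - s := sub_pos.2 hs.2
    rw [Real.norm_of_nonneg (integral_nonneg fun _ => norm_nonneg _)]
    have h1 : ∀ y, ‖duhamelIntegrand hT f u t x s y‖ =
        heatKernel (t - s) (x - y) * |source hT f u s y| := by
      intro y
      rw [duhamelIntegrand, norm_mul, Real.norm_of_nonneg (heatKernel_nonneg h0.le _)]
      rfl
    simp_rw [h1]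
    rw [integral_heatKernel_mul h0 x fun y => |source hT f u s y|]
    exact integral_mono (hslice s hs).norm hH fun v => hb s ⟨hs.1.le, hs.2.le⟩ v

theorem integral_duhamelIntegrand (hT : 0 < T) (f : ℝ → ℝ) (u : SpaceTime T d → ℝ) {t : ℝ}
    (ht : 0 ≤ t) (x : Space d) :
    ∫ s in (0 : ℝ)..t, ∫ y : Space d, duhamelIntegrand hT f u t x s y =
      duhamel (source hT f u) t x := by
  refine intervalIntegral.integral_congr_ae ?_
  filter_upwards [compl_mem_ae_iff.2 (measure_singleton t)] with s hst hs
  rw [uIoc_of_le ht] at hs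
  exact integral_heatKernel_mul (sub_pos.2 (lt_of_le_of_ne hs.2 hst)) x (source hT f u s)

theorem isSolution_iff_isMild (hT : 0 < T) {f : ℝ → ℝ} (hf : Continuous f)
    (z u : SpaceTime T d →ᵇ ℝ) : IsSolution hT f z u ↔ IsMild hT f z u := by
  obtain ⟨M, hM⟩ := exists_abs_source_le hT hf u
  refine forall₂_congr fun t x => ?_
  rw [integral_duhamelIntegrand hT f u t.2.1 x]
  exact and_iff_right (integrable_duhamelIntegrand hT hf u.continuous (integrable_const M)
    fun s _ v => hM s _)

/-- The solution map is well defined on bounded functions. -/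
theorem isSolution_iff_eq_solutionMap (hT : 0 < T) {f : ℝ → ℝ} {κ : ℝ} (h : OneSided f κ)
    (hκ : 0 ≤ κ) (hf : Continuous f) (z u : SpaceTime T d →ᵇ ℝ) :
    IsSolution hT f z u ↔ u = solutionMap hT f z := by
  have hex : ∃ u : SpaceTime T d →ᵇ ℝ, IsSolution hT f z u := by
    obtain ⟨u, hu⟩ := h.exists_isMild hT hκ hf z
    exact ⟨u, (isSolution_iff_isMild hT hf z u).2 hu⟩
  have hs : IsSolution hT f z (solutionMap hT f z) := by
    rw [solutionMap, dif_pos hex]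
    exact hex.choose_spec
  refine ⟨fun hu => ?_, fun hu => hu ▸ hs⟩
  exact IsMild.unique hT h hκ hf ((isSolution_iff_isMild hT hf _ _).1 hu)
    ((isSolution_iff_isMild hT hf _ _).1 hs)

theorem isMild_solutionMap (hT : 0 < T) {f : ℝ → ℝ} {κ : ℝ} (h : OneSided f κ)
    (hκ : 0 ≤ κ) (hf : Continuous f) (z : SpaceTime T d →ᵇ ℝ) :
    IsMild hT f z (solutionMap hT f z) :=
  (isSolution_iff_isMild hT hf _ _).1 ((isSolution_iff_eq_solutionMap hT h hκ hf z _).2 rfl)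

end Existence

/-! ### Equivalence of the two weights. -/

section Weights

variable {d : ℕ}

theorem continuous_weight (x₀ : Space d) {θ : ℝ} (hθ : 0 ≤ θ) : Continuous (weight x₀ θ) := by
  unfold weight
  exact continuous_const.add (Continuous.rpow_const (by fun_prop) fun _ => Or.inr hθ)

theorem weight_le_two_mul_smoothWeight (x₀ : Space d) {θ : ℝ} (hθ : 0 ≤ θ) (x : Space d) :
    weight x₀ θ x ≤ 2 * smoothWeight x₀ (θ / 2) x := by
  have h1 := one_le_smoothWeight x₀ (by positivity : 0 ≤ θ / 2) x
  have h2 : ‖x - x₀‖ ^ θ ≤ smoothWeight x₀ (θ / 2) x := by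
    have : ‖x - x₀‖ ^ θ = (‖x - x₀‖ ^ 2) ^ (θ / 2) := by
      rw [← Real.rpow_natCast, ← Real.rpow_mul (norm_nonneg _)]
      congr 1
      push_cast
      ring
    rw [this]
    exact Real.rpow_le_rpow (by positivity) (by linarith) (by positivity)
  unfold weight
  linarith

theorem smoothWeight_le_mul_weight (x₀ : Space d) {θ : ℝ} (hθ : 0 ≤ θ) (x : Space d) :
    smoothWeight x₀ (θ / 2) x ≤ 2 ^ (θ / 2) * weight x₀ θ x := by
  have hp : 0 ≤ θ / 2 := by positivity
  have hn := norm_nonneg (x - x₀)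
  unfold smoothWeight weight
  rcases le_total ‖x - x₀‖ 1 with h | h
  · calc (1 + ‖x - x₀‖ ^ 2) ^ (θ / 2) ≤ 2 ^ (θ / 2) :=
        Real.rpow_le_rpow (by positivity) (by nlinarith) hp
      _ ≤ _ := le_mul_of_one_le_right (by positivity)
        (le_add_of_nonneg_right (Real.rpow_nonneg hn _))
  · calc (1 + ‖x - x₀‖ ^ 2) ^ (θ / 2) ≤ (2 * ‖x - x₀‖ ^ 2) ^ (θ / 2) :=
        Real.rpow_le_rpow (by positivity) (by nlinarith) hp
      _ = 2 ^ (θ / 2) * ‖x - x₀‖ ^ θ := by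
        rw [Real.mul_rpow (by norm_num) (by positivity), ← Real.rpow_natCast ‖x - x₀‖,
          ← Real.rpow_mul hn]
        congr 2
        push_cast
        ring
      _ ≤ _ := mul_le_mul_of_nonneg_left (by linarith) (by positivity)

end Weights

/-! ### Completeness of the weighted space and density of bounded functions. -/

namespace WeightedC

variable {T : ℝ} {d : ℕ} {x₀ : Space d} {θ : ℝ}

theorem abs_le_norm_mul_weight (ψ : WeightedC T x₀ θ) (q : SpaceTime T d) :
    |ψ q| ≤ ‖ψ‖ * weight x₀ θ q.2 :=
  (div_le_iff₀ (weight_pos _ _ _)).1 (ψ.ratio_le_wnorm q)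

theorem norm_le_of_abs_le {ψ : WeightedC T x₀ θ} {C : ℝ} (hC : 0 ≤ C)
    (h : ∀ q : SpaceTime T d, |ψ q| ≤ C * weight x₀ θ q.2) : ‖ψ‖ ≤ C :=
  Real.iSup_le (fun q => (div_le_iff₀ (weight_pos _ _ _)).2 (h q)) hC

theorem sub_apply (φ ψ : WeightedC T x₀ θ) (q : SpaceTime T d) : (φ - ψ) q = φ q - ψ q := rfl

theorem tendsto_apply {ι : Type*} {l : Filter ι} {ψ : ι → WeightedC T x₀ θ}
    {φ : WeightedC T x₀ θ} (h : Tendsto ψ l (𝓝 φ)) (q : SpaceTime T d) :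
    Tendsto (fun i => ψ i q) l (𝓝 (φ q)) := by
  rw [tendsto_iff_norm_sub_tendsto_zero] at h ⊢
  refine squeeze_zero (fun _ => norm_nonneg _) (fun i => abs_le_norm_mul_weight (ψ i - φ) q) ?_
  simpa using h.mul_const (weight x₀ θ q.2)

/-- Dividing by the weight maps the space isometrically into bounded continuous functions. The limit
there, multiplied back, still decays relative to the weight, because the convergence is uniform. -/
theorem completeSpace (hθ : 0 ≤ θ) : CompleteSpace (WeightedC T x₀ θ) := by
  refine Metric.complete_of_cauchySeq_tendsto fun ψ hψ => ?_
  have hw := continuous_weight x₀ hθ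
  have hratio : ∀ φ : WeightedC T x₀ θ, ∃ g : SpaceTime T d →ᵇ ℝ,
      ∀ q, g q = φ q / weight x₀ θ q.2 := by
    intro φ
    refine ⟨BoundedContinuousFunction.ofNormedAddCommGroup
      (fun q : SpaceTime T d => φ q / weight x₀ θ q.2) ?_ ‖φ‖ fun q => ?_, fun q => rfl⟩
    · exact φ.1.continuous.div (hw.comp continuous_snd) fun q => (weight_pos _ _ _).ne'
    · rw [Real.norm_eq_abs, abs_div, abs_of_pos (weight_pos x₀ θ q.2)]
      exact φ.ratio_le_wnorm q
  choose G hG using hratio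
  have hGd : ∀ φ χ : WeightedC T x₀ θ, dist (G φ) (G χ) ≤ dist φ χ := by
    intro φ χ
    refine (BoundedContinuousFunction.dist_le dist_nonneg).2 fun q => ?_
    rw [hG, hG, Real.dist_eq, ← sub_div, abs_div, abs_of_pos (weight_pos x₀ θ q.2), dist_eq_norm]
    exact (φ - χ).ratio_le_wnorm q
  have hcau : CauchySeq fun n => G (ψ n) := by
    rw [Metric.cauchySeq_iff] at hψ ⊢
    intro ε hε
    obtain ⟨N, hN⟩ := hψ ε hε
    exact ⟨N, fun m hm n hn => (hGd _ _).trans_lt (hN m hm n hn)⟩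
  obtain ⟨g, hg⟩ := cauchySeq_tendsto_of_complete hcau
  rw [tendsto_iff_dist_tendsto_zero] at hg
  set χ : C(SpaceTime T d, ℝ) := ⟨fun q => g q * weight x₀ θ q.2,
    g.continuous.mul (hw.comp continuous_snd)⟩ with hχ
  have hχr : ∀ q : SpaceTime T d, |χ q| / weight x₀ θ q.2 = |g q| := by
    intro q
    rw [hχ, ContinuousMap.coe_mk, abs_mul, abs_of_pos (weight_pos x₀ θ q.2),
      mul_div_cancel_right₀ _ (weight_pos x₀ θ q.2).ne']
  have hmem : χ ∈ weightedSubmodule T x₀ θ := by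
    change Tendsto (fun x => ⨆ t : Icc (0 : ℝ) T, |χ (t, x)| / weight x₀ θ x)
      (Bornology.cobounded (Space d)) (𝓝 0)
    refine Metric.tendsto_nhds.2 fun ε hε => ?_
    obtain ⟨n, hn⟩ := (hg.eventually_lt_const (half_pos hε)).exists
    have h1 : ∀ᶠ x in Bornology.cobounded (Space d),
        (⨆ t : Icc (0 : ℝ) T, |ψ n (t, x)| / weight x₀ θ x) < ε / 2 :=
      Tendsto.eventually_lt_const (half_pos hε) (ψ n).2
    filter_upwards [h1] with x hx
    have h2 : (⨆ t : Icc (0 : ℝ) T, |χ (t, x)| / weight x₀ θ x) ≤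
        dist (G (ψ n)) g + ⨆ t : Icc (0 : ℝ) T, |ψ n (t, x)| / weight x₀ θ x := by
      refine Real.iSup_le (fun t => ?_) (add_nonneg dist_nonneg
        (Real.iSup_nonneg fun t => (ψ n).ratio_nonneg (t, x)))
      have h3 : |ψ n (t, x)| / weight x₀ θ x ≤
          ⨆ t : Icc (0 : ℝ) T, |ψ n (t, x)| / weight x₀ θ x :=
        le_ciSup (bddAbove_slice x₀ θ (ψ n).1 x) t
      have h4 := BoundedContinuousFunction.dist_coe_le_dist (f := G (ψ n)) (g := g) (t, x)
      rw [hχr (t, x)]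
      have h5 : |G (ψ n) (t, x)| = |ψ n (t, x)| / weight x₀ θ x := by
        rw [hG, abs_div, abs_of_pos (weight_pos x₀ θ x)]
      rw [Real.dist_eq, abs_sub_comm] at h4
      have h6 := abs_sub_abs_le_abs_sub (g (t, x)) (G (ψ n) (t, x))
      linarith
    rw [Real.dist_eq, sub_zero, abs_of_nonneg (Real.iSup_nonneg fun t =>
      div_nonneg (abs_nonneg _) (weight_pos x₀ θ x).le)]
    linarith
  obtain ⟨ξ, hξ⟩ : ∃ ξ : WeightedC T x₀ θ, ∀ q, ξ q = g q * weight x₀ θ q.2 :=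
    ⟨⟨χ, hmem⟩, fun q => rfl⟩
  refine ⟨ξ, ?_⟩
  rw [tendsto_iff_norm_sub_tendsto_zero]
  refine squeeze_zero (fun _ => norm_nonneg _) (fun n => norm_le_of_abs_le dist_nonneg fun q => ?_)
    hg
  have h4 := BoundedContinuousFunction.dist_coe_le_dist (f := G (ψ n)) (g := g) q
  rw [Real.dist_eq, hG] at h4
  have hwq := weight_pos x₀ θ q.2
  have h5 : ψ n q - g q * weight x₀ θ q.2 = (ψ n q / weight x₀ θ q.2 - g q) * weight x₀ θ q.2 := by
    field_simp
  rw [sub_apply, hξ, h5, abs_mul, abs_of_pos hwq]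
  exact mul_le_mul_of_nonneg_right h4 hwq.le

/-- The truncation of a weighted function to values in `[-n, n]`. -/
noncomputable def truncate (ψ : WeightedC T x₀ θ) (n : ℕ) : SpaceTime T d →ᵇ ℝ :=
  BoundedContinuousFunction.ofNormedAddCommGroup (fun q => max (-(n : ℝ)) (min (ψ q) n))
    (continuous_const.max (ψ.1.continuous.min continuous_const)) n fun q => by
      rw [Real.norm_eq_abs, abs_le]
      exact ⟨le_max_left _ _, max_le (by linarith [Nat.cast_nonneg (α := ℝ) n]) (min_le_right _ _)⟩

theorem truncate_apply (ψ : WeightedC T x₀ θ) (n : ℕ) (q : SpaceTime T d) :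
    truncate ψ n q = max (-(n : ℝ)) (min (ψ q) n) := rfl

/-- Outside a compact set the decay condition makes `ψ`, hence the truncation error, small relative
to the weight; on the compact set truncation eventually changes nothing. -/
theorem tendsto_truncate (hθ : 0 < θ) (ψ : WeightedC T x₀ θ) :
    Tendsto (fun n => ofBounded x₀ hθ (truncate ψ n)) atTop (𝓝 ψ) := by
  rw [tendsto_iff_norm_sub_tendsto_zero]
  refine Metric.tendsto_nhds.2 fun ε hε => ?_
  have h : ∀ᶠ x in Bornology.cobounded (Space d),
      (⨆ t : Icc (0 : ℝ) T, |ψ (t, x)| / weight x₀ θ x) < ε / 2 :=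
    Tendsto.eventually_lt_const (half_pos hε) ψ.2
  rw [Metric.cobounded_eq_cocompact] at h
  obtain ⟨S, hS, hSc⟩ := mem_cocompact.1 h
  have hc : Continuous fun p : SpaceTime T d => |ψ p| := ψ.1.continuous.abs
  obtain ⟨B, hB⟩ := ((isCompact_univ (X := Icc (0 : ℝ) T)).prod hS).bddAbove_image hc.continuousOn
  filter_upwards [eventually_ge_atTop ⌈B⌉₊] with n hn
  have hBn : B ≤ n := (Nat.le_ceil B).trans (Nat.cast_le.2 hn)
  rw [Real.dist_eq, sub_zero, abs_of_nonneg (norm_nonneg _)]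
  refine lt_of_le_of_lt (norm_le_of_abs_le (half_pos hε).le fun q => ?_) (half_lt_self hε)
  rw [sub_apply, ofBounded_apply, truncate_apply]
  have hn0 := Nat.cast_nonneg (α := ℝ) n
  by_cases hx : q.2 ∈ S
  · have h1 : |ψ q| ≤ n := (hB ⟨q, ⟨mem_univ _, hx⟩, rfl⟩).trans hBn
    rw [abs_le] at h1
    rw [min_eq_left h1.2, max_eq_right h1.1, sub_self, abs_zero]
    exact mul_nonneg (half_pos hε).le (weight_pos _ _ _).le
  · have h1 : |ψ q| / weight x₀ θ q.2 ≤ ε / 2 :=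
      (le_ciSup (bddAbove_slice x₀ θ ψ.1 q.2) q.1).trans (hSc hx).le
    refine le_trans ?_ ((div_le_iff₀ (weight_pos _ _ _)).1 h1)
    rcases le_total (ψ q) n with h2 | h2
    · rw [min_eq_left h2]
      rcases le_total (-(n : ℝ)) (ψ q) with h3 | h3
      · rw [max_eq_right h3, sub_self, abs_zero]; exact abs_nonneg _
      · rw [max_eq_left h3, abs_of_nonneg (by linarith), abs_of_nonpos (by linarith)]
        linarith
    · rw [min_eq_right h2, max_eq_right (by linarith), abs_of_nonpos (by linarith),
        abs_of_nonneg (by linarith)]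
      linarith

end WeightedC

/-! ### Lipschitz extension of the solution map. -/

section Extension

variable {T : ℝ} {d : ℕ} {x₀ : Space d} {θ : ℝ}

theorem norm_solutionMap_sub_le (hT : 0 < T) (hθ : 0 < θ) {f : ℝ → ℝ} {κ : ℝ} (h : OneSided f κ)
    (hκ : 0 ≤ κ) (hf : Continuous f) (z₁ z₂ : SpaceTime T d →ᵇ ℝ) :
    ‖WeightedC.ofBounded x₀ hθ (solutionMap hT f z₁) -
        WeightedC.ofBounded x₀ hθ (solutionMap hT f z₂)‖ ≤
      4 * 2 ^ (θ / 2) * Real.exp (comparisonRate d (θ / 2) κ * T) *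
        ‖WeightedC.ofBounded x₀ hθ z₁ - WeightedC.ofBounded x₀ hθ z₂‖ := by
  set N := ‖WeightedC.ofBounded x₀ hθ z₁ - WeightedC.ofBounded x₀ hθ z₂‖
  have hN : 0 ≤ N := norm_nonneg _
  refine WeightedC.norm_le_of_abs_le (by positivity) fun q => ?_
  -- The doubled norm in `δ` pays for passing from the weight to the smooth weight; the return costs
  -- `2^(θ/2)`.
  have h1 := (isMild_solutionMap hT h hκ hf z₁).abs_sub_le hT h hκ hf hf
    (isMild_solutionMap hT h hκ hf z₂) (x₀ := x₀) (p := θ / 2) (δ := 2 * N) (by positivity)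
    (by positivity) (fun q => by rw [sub_self, abs_zero]; positivity)
    (fun q => by
      refine ((WeightedC.ofBounded x₀ hθ z₁ -
        WeightedC.ofBounded x₀ hθ z₂).abs_le_norm_mul_weight q).trans ?_
      refine (mul_le_mul_of_nonneg_left (weight_le_two_mul_smoothWeight x₀ hθ.le q.2) hN).trans_eq ?_
      ring) q
  refine h1.trans ((mul_le_mul_of_nonneg_left (smoothWeight_le_mul_weight x₀ hθ.le q.2)
    (by positivity)).trans_eq ?_)
  ring

/-- Comparison with the zero function, a solution for the zero drift and zero datum. The drift error
is then `|f 0|`, the only information on the size of `f` that enters. -/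
theorem norm_solutionMap_le (hT : 0 < T) (hθ : 0 < θ) {f : ℝ → ℝ} {κ : ℝ} (h : OneSided f κ)
    (hκ : 0 ≤ κ) (hf : Continuous f) (z : SpaceTime T d →ᵇ ℝ) :
    ‖WeightedC.ofBounded x₀ hθ (solutionMap hT f z)‖ ≤
      2 * (2 + |f 0|) * 2 ^ (θ / 2) * Real.exp (comparisonRate d (θ / 2) κ * T) *
        (1 + ‖WeightedC.ofBounded x₀ hθ z‖) := by
  set N := ‖WeightedC.ofBounded x₀ hθ z‖
  have hN : 0 ≤ N := norm_nonneg _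
  refine WeightedC.norm_le_of_abs_le (by positivity) fun q => ?_
  have h1 := (isMild_solutionMap hT h hκ hf z).abs_sub_le hT h hκ hf (f₂ := fun _ => 0)
    continuous_const (isMild_zero hT) (x₀ := x₀) (p := θ / 2) (δ := 2 * N + |f 0|)
    (by positivity) (by positivity)
    (fun q => by
      simp only [BoundedContinuousFunction.coe_zero, Pi.zero_apply, zero_sub, abs_neg]
      linarith)
    (fun q => by
      simp only [BoundedContinuousFunction.coe_zero, Pi.zero_apply, sub_zero]
      refine ((WeightedC.ofBounded x₀ hθ z).abs_le_norm_mul_weight q).trans ?_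
      refine (mul_le_mul_of_nonneg_left (weight_le_two_mul_smoothWeight x₀ hθ.le q.2) hN).trans ?_
      nlinarith [mul_nonneg (abs_nonneg (f 0)) (smoothWeight_pos x₀ (θ / 2) q.2).le]) q
  simp only [BoundedContinuousFunction.coe_zero, Pi.zero_apply, sub_zero] at h1
  refine h1.trans ((mul_le_mul_of_nonneg_left (smoothWeight_le_mul_weight x₀ hθ.le q.2)
    (by positivity)).trans ?_)
  have h2 : 2 * (2 * N + |f 0|) ≤ 2 * (2 + |f 0|) * (1 + N) := by
    nlinarith [mul_nonneg (abs_nonneg (f 0)) hN]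
  have hw := (weight_pos x₀ θ q.2).le
  calc _ = 2 * (2 * N + |f 0|) * (2 ^ (θ / 2) * Real.exp (comparisonRate d (θ / 2) κ * T) *
        weight x₀ θ q.2) := by ring
    _ ≤ 2 * (2 + |f 0|) * (1 + N) * (2 ^ (θ / 2) * Real.exp (comparisonRate d (θ / 2) κ * T) *
        weight x₀ θ q.2) := mul_le_mul_of_nonneg_right h2 (by positivity)
    _ = _ := by ring

theorem exists_isContinuousExtension (hT : 0 < T) (hθ : 0 < θ) {f : ℝ → ℝ} {κ : ℝ}
    (h : OneSided f κ) (hκ : 0 ≤ κ) (hf : Continuous f) :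
    ∃ E : WeightedC T x₀ θ → WeightedC T x₀ θ, IsContinuousExtension hT hθ f E := by
  have hcs : CompleteSpace (WeightedC T x₀ θ) := WeightedC.completeSpace hθ.le
  set C := 4 * 2 ^ (θ / 2) * Real.exp (comparisonRate d (θ / 2) κ * T) with hC
  have hC0 : 0 ≤ C := by positivity
  set I := WeightedC.ofBounded (T := T) x₀ hθ
  have hLip : ∀ z₁ z₂, dist (I (solutionMap hT f z₁)) (I (solutionMap hT f z₂)) ≤
      C * dist (I z₁) (I z₂) := fun z₁ z₂ => by
    rw [dist_eq_norm, dist_eq_norm]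
    exact norm_solutionMap_sub_le hT hθ h hκ hf z₁ z₂
  have hcau : ∀ ψ : WeightedC T x₀ θ, CauchySeq fun n => I (solutionMap hT f (ψ.truncate n)) := by
    intro ψ
    have h1 := (WeightedC.tendsto_truncate hθ ψ).cauchySeq
    rw [Metric.cauchySeq_iff] at h1 ⊢
    intro ε hε
    obtain ⟨N, hN⟩ := h1 (ε / (C + 1)) (by positivity)
    refine ⟨N, fun m hm n hn => (hLip _ _).trans_lt ?_⟩
    have h2 := (lt_div_iff₀ (by positivity)).1 (hN m hm n hn)
    have h3 : 0 ≤ dist (I (ψ.truncate m)) (I (ψ.truncate n)) := dist_nonneg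
    have h4 : dist (I (ψ.truncate m)) (I (ψ.truncate n)) * (C + 1) < ε := h2
    nlinarith
  choose E hE using fun ψ => cauchySeq_tendsto_of_complete (hcau ψ)
  refine ⟨E, ?_, fun z => ?_⟩
  · have hl : LipschitzWith C.toNNReal E := LipschitzWith.of_dist_le_mul fun φ ψ => by
      rw [Real.coe_toNNReal _ hC0]
      exact le_of_tendsto_of_tendsto' ((hE φ).dist (hE ψ))
        (((WeightedC.tendsto_truncate hθ φ).dist (WeightedC.tendsto_truncate hθ ψ)).const_mul C)
        fun n => hLip _ _
    exact hl.continuous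
  · refine tendsto_nhds_unique (hE (I z)) ?_
    rw [tendsto_iff_dist_tendsto_zero]
    have h1 := (tendsto_iff_dist_tendsto_zero.1
      (WeightedC.tendsto_truncate hθ (I z))).const_mul C
    rw [mul_zero] at h1
    exact squeeze_zero (fun _ => dist_nonneg) (fun n => hLip _ _) h1

theorem IsContinuousExtension.tendsto {hT : 0 < T} {hθ : 0 < θ} {f : ℝ → ℝ}
    {E : WeightedC T x₀ θ → WeightedC T x₀ θ} (hE : IsContinuousExtension hT hθ f E)
    (z : WeightedC T x₀ θ) :
    Tendsto (fun n => WeightedC.ofBounded x₀ hθ (solutionMap hT f (z.truncate n))) atTop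
      (𝓝 (E z)) := by
  have h1 := (hE.1.tendsto z).comp (WeightedC.tendsto_truncate hθ z)
  exact h1.congr fun n => hE.2 _

theorem IsContinuousExtension.unique {hT : 0 < T} {hθ : 0 < θ} {f : ℝ → ℝ}
    {E E' : WeightedC T x₀ θ → WeightedC T x₀ θ} (hE : IsContinuousExtension hT hθ f E)
    (hE' : IsContinuousExtension hT hθ f E') : E = E' :=
  funext fun z => tendsto_nhds_unique (hE.tendsto z) (hE'.tendsto z)

theorem IsContinuousExtension.norm_sub_le {hT : 0 < T} {hθ : 0 < θ} {f : ℝ → ℝ} {κ : ℝ}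
    {E : WeightedC T x₀ θ → WeightedC T x₀ θ} (hE : IsContinuousExtension hT hθ f E)
    (h : OneSided f κ) (hκ : 0 ≤ κ) (hf : Continuous f) (z₁ z₂ : WeightedC T x₀ θ) :
    ‖E z₁ - E z₂‖ ≤
      4 * 2 ^ (θ / 2) * Real.exp (comparisonRate d (θ / 2) κ * T) * ‖z₁ - z₂‖ :=
  le_of_tendsto_of_tendsto' ((hE.tendsto z₁).sub (hE.tendsto z₂)).norm
    (((WeightedC.tendsto_truncate hθ z₁).sub (WeightedC.tendsto_truncate hθ z₂)).norm.const_mul _)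
    fun _ => norm_solutionMap_sub_le hT hθ h hκ hf _ _

theorem IsContinuousExtension.norm_le {hT : 0 < T} {hθ : 0 < θ} {f : ℝ → ℝ} {κ : ℝ}
    {E : WeightedC T x₀ θ → WeightedC T x₀ θ} (hE : IsContinuousExtension hT hθ f E)
    (h : OneSided f κ) (hκ : 0 ≤ κ) (hf : Continuous f) (z : WeightedC T x₀ θ) :
    ‖E z‖ ≤ 2 * (2 + |f 0|) * 2 ^ (θ / 2) * Real.exp (comparisonRate d (θ / 2) κ * T) *
      (1 + ‖z‖) :=
  le_of_tendsto_of_tendsto' (hE.tendsto z).norm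
    (((WeightedC.tendsto_truncate hθ z).norm.const_add 1).const_mul _)
    fun _ => norm_solutionMap_le hT hθ h hκ hf _

end Extension

/-! ### Growth below the threshold: the equation survives the limit. -/

section Subcritical

variable {T : ℝ} {d : ℕ} {x₀ : Space d} {θ : ℝ}

theorem exists_rpow_le_add_sq {A q : ℝ} (hA : 0 ≤ A) (hq : 0 ≤ q) (hq2 : q < 2) :
    ∃ M, ∀ r : ℝ, 0 ≤ r → A * (1 + r) ^ q ≤ M + r ^ 2 / 4 := by
  have h1 : Tendsto (fun r : ℝ => A * (1 + r) ^ (-(2 - q))) atTop (𝓝 (A * 0)) :=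
    ((tendsto_rpow_neg_atTop (by linarith)).comp
      (tendsto_atTop_add_const_left _ 1 tendsto_id)).const_mul A
  rw [mul_zero] at h1
  obtain ⟨R, hR⟩ := eventually_atTop.1 (h1.eventually_lt_const (by norm_num : (0 : ℝ) < 1 / 16))
  refine ⟨1 / 8 + A * (1 + max R 0) ^ q, fun r hr => ?_⟩
  have hpos : 0 ≤ A * (1 + max R 0) ^ q := by positivity
  rcases le_total R r with h | h
  · have h2 := hR r h
    have h3 : (1 + r) ^ q = (1 + r) ^ (-(2 - q)) * (1 + r) ^ 2 := by
      rw [← Real.rpow_natCast, ← Real.rpow_add (by positivity)]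
      congr 1
      push_cast
      ring
    rw [h3, ← mul_assoc]
    nlinarith [mul_le_mul_of_nonneg_right h2.le (sq_nonneg (1 + r)), sq_nonneg (1 - r)]
  · have h2 : (1 + r) ^ q ≤ (1 + max R 0) ^ q :=
      Real.rpow_le_rpow (by positivity) (by linarith [le_max_left R 0]) hq
    nlinarith [mul_le_mul_of_nonneg_left h2 hA, sq_nonneg r]

/-- The exponent in the growth bound of `f(u)` is of order `r^(θν)`, which is subquadratic. It
therefore fits under the Gaussian majorant `exp(M + r²/4)`. -/
theorem exists_growth_le_add_sq {K B a b ν : ℝ} (hK : 0 ≤ K) (hB : 0 ≤ B) (ha : 0 ≤ a)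
    (hb : 0 ≤ b) (hθ : 0 ≤ θ) (hν : 0 ≤ ν) (hθν : θ * ν < 2) :
    ∃ M, ∀ r : ℝ, 0 ≤ r → K * (B * (1 + (a + b * r) ^ θ)) ^ ν ≤ M + r ^ 2 / 4 := by
  set c := 1 + a + b with hc
  have hc1 : 1 ≤ c := by linarith
  obtain ⟨M, hM⟩ := exists_rpow_le_add_sq (A := K * (2 * B * c ^ θ) ^ ν) (q := θ * ν)
    (by positivity) (by positivity) hθν
  refine ⟨M, fun r hr => le_trans ?_ (hM r hr)⟩
  have h1 : (a + b * r) ^ θ ≤ (c * (1 + r)) ^ θ :=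
    Real.rpow_le_rpow (by positivity) (by nlinarith [mul_nonneg ha hr, mul_nonneg hb hr]) hθ
  have h2 : 1 ≤ (c * (1 + r)) ^ θ :=
    Real.one_le_rpow (one_le_mul_of_one_le_of_one_le hc1 (by linarith)) hθ
  have h3 : B * (1 + (a + b * r) ^ θ) ≤ 2 * B * c ^ θ * (1 + r) ^ θ := by
    rw [mul_assoc (2 * B), ← Real.mul_rpow (by positivity) (by positivity)]
    nlinarith
  have h4 := Real.rpow_le_rpow (by positivity) h3 hν
  rw [Real.mul_rpow (x := 2 * B * c ^ θ) (by positivity) (by positivity),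
    ← Real.rpow_mul (by positivity)] at h4
  rw [mul_assoc]
  exact mul_le_mul_of_nonneg_left h4 hK

/-- Below the critical growth the extended solution map still solves the equation. -/
theorem IsContinuousExtension.isSolution {hT : 0 < T} {hθ : 0 < θ} {f : ℝ → ℝ} {κ K ν : ℝ}
    {E : WeightedC T x₀ θ → WeightedC T x₀ θ} (hE : IsContinuousExtension hT hθ f E)
    (hf : DriftAssumption f κ K ν) (hθν : θ * ν < 2) (z : WeightedC T x₀ θ) :
    IsSolution hT f z (E z) := by
  have hs : OneSided f (max κ 0) := fun a b hab => (hf.oneSidedLipschitz a b hab).trans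
    (mul_le_mul_of_nonneg_right (le_max_left _ _) (sub_pos.2 hab).le)
  intro t x
  set u : ℕ → SpaceTime T d →ᵇ ℝ := fun n => solutionMap hT f (z.truncate n) with hu
  have hlim := hE.tendsto z
  obtain ⟨B, hB⟩ := hlim.norm.bddAbove_range
  have hBn : ∀ n, ‖WeightedC.ofBounded x₀ hθ (u n)‖ ≤ B := fun n => hB ⟨n, rfl⟩
  have hB0 : 0 ≤ B := (norm_nonneg _).trans (hBn 0)
  have hBE : ‖E z‖ ≤ B := le_of_tendsto' hlim.norm hBn
  obtain ⟨M, hM⟩ := exists_growth_le_add_sq (θ := θ) (K := K) (B := B) (a := ‖x - x₀‖) (b := √T)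
    hf.K_pos.le hB0 (norm_nonneg _) (Real.sqrt_nonneg _) hθ.le hf.ν_nonneg hθν
  have hH : Integrable (fun v : Space d => K * Real.exp (M + ‖v‖ ^ 2 / 4))
      (stdGaussian (Space d)) := (integrable_exp_quarter_sq_norm M).const_mul K
  -- A single majorant for all `s` and for the whole norm ball of radius `B`, so it serves both the
  -- limit `E z` and the approximating solutions.
  have hsource : ∀ ψ : WeightedC T x₀ θ, ‖ψ‖ ≤ B → ∀ s ∈ Icc (0 : ℝ) t, ∀ v : Space d,
      |source hT f ψ s (x + √(t - s) • v)| ≤ K * Real.exp (M + ‖v‖ ^ 2 / 4) := by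
    intro ψ hψ s hs v
    refine (hf.growth _).trans (mul_le_mul_of_nonneg_left (Real.exp_le_exp.2 ?_) hf.K_pos.le)
    refine le_trans (mul_le_mul_of_nonneg_left ?_ hf.K_pos.le) (hM ‖v‖ (norm_nonneg v))
    refine Real.rpow_le_rpow (abs_nonneg _) ?_ hf.ν_nonneg
    refine (ψ.abs_le_norm_mul_weight _).trans (mul_le_mul hψ ?_ (weight_pos _ _ _).le hB0)
    refine add_le_add_right (Real.rpow_le_rpow (norm_nonneg _) ?_ hθ.le) 1
    have h1 := norm_add_le (x - x₀) (√(t - s) • v)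
    rw [norm_smul, Real.norm_of_nonneg (Real.sqrt_nonneg _)] at h1
    have h2 : √(t - s) ≤ √T := Real.sqrt_le_sqrt (by linarith [hs.1, t.2.2])
    rw [show x + √(t - s) • v - x₀ = x - x₀ + √(t - s) • v by abel]
    exact h1.trans (add_le_add_right (mul_le_mul_of_nonneg_right h2 (norm_nonneg v)) _)
  refine ⟨integrable_duhamelIntegrand hT hf.continuous (E z).1.continuous hH
    (hsource (E z) hBE), ?_⟩
  rw [integral_duhamelIntegrand hT f _ t.2.1 x]
  have h1 : Tendsto (fun n => duhamel (source hT f (u n)) t x) atTop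
      (𝓝 (duhamel (source hT f (E z)) t x)) :=
    tendsto_duhamel t.2.1 hH
      (fun n => continuous_source hT hf.continuous (u n).continuous)
      (fun n => hsource (WeightedC.ofBounded x₀ hθ (u n)) (hBn n))
      fun s _ y => (hf.continuous.tendsto _).comp
        (WeightedC.tendsto_apply hlim (projIcc 0 T hT.le s, y))
  have h2 := h1.add (WeightedC.tendsto_apply (WeightedC.tendsto_truncate hθ z) (t, x))
  refine tendsto_nhds_unique (WeightedC.tendsto_apply hlim (t, x)) (h2.congr fun n => ?_)
  exact (isMild_solutionMap hT hs (le_max_right _ _) hf.continuous (z.truncate n) t x).symm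

end Subcritical

/-! ### Growth above the threshold: a counterexample. -/

section Supercritical

variable {T : ℝ} {d : ℕ} {x₀ : Space d} {θ : ℝ}

/-- The Duhamel integral vanishes at time zero for bounded data, and evaluation at a point is
continuous. The extended solution is thus known exactly at time zero, where the counterexample is
tested. -/
theorem IsContinuousExtension.apply_zero {hT : 0 < T} {hθ : 0 < θ} {f : ℝ → ℝ} {κ : ℝ}
    {E : WeightedC T x₀ θ → WeightedC T x₀ θ} (hE : IsContinuousExtension hT hθ f E)
    (h : OneSided f κ) (hκ : 0 ≤ κ) (hf : Continuous f) (z : WeightedC T x₀ θ) (y : Space d) :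
    E z (⟨0, left_mem_Icc.2 hT.le⟩, y) = z (⟨0, left_mem_Icc.2 hT.le⟩, y) := by
  refine tendsto_nhds_unique (WeightedC.tendsto_apply (hE.tendsto z) _)
    ((WeightedC.tendsto_apply (WeightedC.tendsto_truncate hθ z) _).congr fun n => ?_)
  have h1 := isMild_solutionMap hT h hκ hf (z.truncate n) ⟨0, left_mem_Icc.2 hT.le⟩ y
  simp only [duhamel, intervalIntegral.integral_same, zero_add] at h1
  exact h1.symm

/-- A drift with the growth `exp(|u|^ν)`. -/
theorem driftAssumption_one_sub_exp {ν : ℝ} (hν : 0 < ν) :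
    DriftAssumption (fun u => 1 - Real.exp (max u 0 ^ ν)) 0 1 ν where
  continuous := continuous_const.sub (Real.continuous_exp.comp
    ((continuous_id.max continuous_const).rpow_const fun _ => Or.inr hν.le))
  oneSidedLipschitz u₁ u₂ h := by
    have h1 : max u₁ 0 ^ ν ≤ max u₂ 0 ^ ν :=
      Real.rpow_le_rpow (le_max_right _ _) (max_le_max h.le le_rfl) hν.le
    linarith [Real.exp_le_exp.2 h1]
  K_pos := one_pos
  ν_nonneg := hν.le
  growth u := by
    have h0 : 0 ≤ max u 0 ^ ν := Real.rpow_nonneg (le_max_right _ _) _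
    have h1 : max u 0 ^ ν ≤ |u| ^ ν :=
      Real.rpow_le_rpow (le_max_right _ _) (max_le (le_abs_self u) (abs_nonneg u)) hν.le
    rw [abs_sub_comm, abs_of_nonneg (by linarith [Real.one_le_exp h0]), one_mul, one_mul]
    linarith [Real.exp_le_exp.2 h1]

theorem tendsto_norm_sub_cobounded (x₀ : Space d) :
    Tendsto (fun x : Space d => ‖x - x₀‖) (Bornology.cobounded (Space d)) atTop :=
  tendsto_atTop_mono (fun x => norm_sub_norm_le x x₀)
    (tendsto_atTop_add_const_right _ _ tendsto_norm_cobounded_atTop)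

theorem exists_weightedC_rpow (T : ℝ) (x₀ : Space d) {α : ℝ} (hα : 0 ≤ α) (hαθ : α < θ) :
    ∃ z : WeightedC T x₀ θ, ∀ q, z q = ‖q.2 - x₀‖ ^ α := by
  have hc : Continuous fun q : SpaceTime T d => ‖q.2 - x₀‖ ^ α :=
    Continuous.rpow_const (by fun_prop) fun _ => Or.inr hα
  have hmem : (⟨_, hc⟩ : C(SpaceTime T d, ℝ)) ∈ weightedSubmodule T x₀ θ := by
    have hlim : Tendsto (fun x : Space d => ‖x - x₀‖ ^ (-(θ - α))) (Bornology.cobounded (Space d))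
        (𝓝 0) := (tendsto_rpow_neg_atTop (sub_pos.2 hαθ)).comp (tendsto_norm_sub_cobounded x₀)
    refine squeeze_zero' (Eventually.of_forall fun x => Real.iSup_nonneg fun t =>
      div_nonneg (abs_nonneg _) (weight_pos x₀ θ x).le) ?_ hlim
    filter_upwards [(tendsto_norm_sub_cobounded x₀).eventually_gt_atTop 0] with x hx
    refine Real.iSup_le (fun t => ?_) (Real.rpow_nonneg (norm_nonneg _) _)
    rw [div_le_iff₀ (weight_pos x₀ θ x), ContinuousMap.coe_mk,
      abs_of_nonneg (Real.rpow_nonneg (norm_nonneg _) _), weight, mul_add, mul_one,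
      ← Real.rpow_add hx, show -(θ - α) + θ = α by ring]
    exact le_add_of_nonneg_left (Real.rpow_nonneg (norm_nonneg _) _)
  exact ⟨⟨_, hmem⟩, fun q => rfl⟩

/-- In positive dimension the complement of a bounded set has infinite volume. -/
theorem not_integrable_of_eventually_one_le_norm (hd : 1 ≤ d) {h : Space d → ℝ}
    (hh : ∀ᶠ y in Bornology.cobounded (Space d), 1 ≤ ‖h y‖) : ¬ Integrable h := by
  intro hi
  have hne : Nonempty (Fin d) := ⟨⟨0, hd⟩⟩
  have hnc : NoncompactSpace (Space d) := NormedSpace.noncompactSpace ℝ (Space d)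
  have h1 : volume {y | 1 ≤ ‖h y‖} < ⊤ := hi.measure_norm_ge_lt_top one_pos
  have h2 : volume {y | 1 ≤ ‖h y‖}ᶜ < ⊤ :=
    (Bornology.isBounded_def.2 (by rwa [compl_compl])).measure_lt_top
  have h3 : volume (univ : Set (Space d)) ≤
      volume {y | 1 ≤ ‖h y‖} + volume {y | 1 ≤ ‖h y‖}ᶜ := by
    rw [← union_compl_self {y | 1 ≤ ‖h y‖}]
    exact measure_union_le _ _
  have h4 := h3.trans_lt (ENNReal.add_lt_top.2 ⟨h1, h2⟩)
  rw [measure_univ_of_isAddLeftInvariant] at h4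
  exact lt_irrefl _ h4

theorem eventually_one_le_mul_exp_sub {c a q : ℝ} (hc : 0 < c) (ha : 0 ≤ a) (hq : 2 < q) :
    ∀ᶠ r : ℝ in atTop, 1 ≤ c * Real.exp (-(a * r ^ 2)) * (Real.exp (r ^ q) - 1) := by
  -- The factored form of `r^q - a r²`, which tends to infinity because `q > 2`.
  have h1 : Tendsto (fun r : ℝ => r ^ 2 * (r ^ (q - 2) + -a)) atTop atTop :=
    (tendsto_pow_atTop two_ne_zero).atTop_mul_atTop₀
      (tendsto_atTop_add_const_right _ _ (tendsto_rpow_atTop (by linarith)))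
  filter_upwards [h1.eventually_ge_atTop (1 / c), eventually_gt_atTop 0] with r hr hr0
  have h2 : r ^ 2 * (r ^ (q - 2) + -a) = -(a * r ^ 2) + r ^ q := by
    have : r ^ q = r ^ 2 * r ^ (q - 2) := by
      rw [← Real.rpow_natCast, ← Real.rpow_add hr0]
      congr 1
      push_cast
      ring
    rw [this]
    ring
  rw [h2] at hr
  have h3 := Real.add_one_le_exp (-(a * r ^ 2) + r ^ q)
  have h4 : Real.exp (-(a * r ^ 2)) ≤ 1 := Real.exp_le_one_iff.2 (by
    have : 0 ≤ a * r ^ 2 := by positivity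
    linarith)
  rw [mul_assoc, mul_sub, ← Real.exp_add, mul_one]
  calc 1 = c * (1 / c) := by field_simp
    _ ≤ _ := mul_le_mul_of_nonneg_left (by linarith) hc.le

theorem heatKernel_sub_comm (t : ℝ) (x y : Space d) :
    heatKernel t (x - y) =
      (2 * Real.pi * t) ^ (-(d : ℝ) / 2) * Real.exp (-(1 / (2 * t) * ‖y - x‖ ^ 2)) := by
  rw [heatKernel, norm_sub_rev]
  ring_nf

end Supercritical

/-! ### The main theorem. -/

theorem theorem5 (d : ℕ) (hd : 1 ≤ d) (θ : ℝ) (hθ : 0 < θ) :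
    (∀ κ : ℝ, ∃ C : ℝ, 0 < C ∧ ∀ F : ℝ, ∃ C' : ℝ, 0 < C' ∧
      ∀ (f : ℝ → ℝ) (K ν : ℝ), DriftAssumption f κ K ν → |f 0| ≤ F →
      ∀ (T : ℝ) (hT : 0 < T),
        -- `M` is well defined on `C_b`: there is exactly one solution, and `M z` is it
        (∀ z u : SpaceTime T d →ᵇ ℝ, IsSolution hT f z u ↔ u = solutionMap hT f z) ∧
        ∀ x₀ : Space d,
          (∃! E : WeightedC T x₀ θ → WeightedC T x₀ θ, IsContinuousExtension hT hθ f E) ∧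
          ∀ E : WeightedC T x₀ θ → WeightedC T x₀ θ, IsContinuousExtension hT hθ f E →
            (∀ z₁ z₂ : WeightedC T x₀ θ,
              ‖E z₁ - E z₂‖ ≤ C * Real.exp (C * T) * ‖z₁ - z₂‖) ∧
            (∀ z : WeightedC T x₀ θ, ‖E z‖ ≤ C' * Real.exp (C' * T) * (1 + ‖z‖)) ∧
            (θ * ν < 2 → ∀ z : WeightedC T x₀ θ, IsSolution hT f z (E z))) ∧
    -- beyond the threshold the integrand need not be integrable
    (∀ ν : ℝ, 0 < ν → 2 / ν < θ → ∀ (T : ℝ) (hT : 0 < T) (x₀ : Space d),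
      ∃ (f : ℝ → ℝ) (κ K : ℝ), DriftAssumption f κ K ν ∧
        ∃ E : WeightedC T x₀ θ → WeightedC T x₀ θ, IsContinuousExtension hT hθ f E ∧
          ∃ (z : WeightedC T x₀ θ) (s t : ℝ) (x : Space d), 0 ≤ s ∧ s < t ∧ t ≤ T ∧
            ¬ Integrable (fun y : Space d => duhamelIntegrand hT f (E z) t x s y)) := by
  constructor
  · intro κ
    -- The estimates need a nonnegative one-sided constant, so `κ` is replaced by its positive part.
    -- The maximum of prefactor and rate then serves as the single constant in both places.
    set lam := comparisonRate d (θ / 2) (max κ 0)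
    have hmul : ∀ A T : ℝ, 0 ≤ A → 0 < T →
        A * Real.exp (lam * T) ≤ max A lam * Real.exp (max A lam * T) := fun A T hA hT =>
      mul_le_mul (le_max_left _ _)
        (Real.exp_le_exp.2 (mul_le_mul_of_nonneg_right (le_max_right _ _) hT.le))
        (Real.exp_pos _).le (hA.trans (le_max_left _ _))
    refine ⟨max (4 * 2 ^ (θ / 2)) lam, lt_max_of_lt_left (by positivity), fun F =>
      ⟨max (2 * (2 + |F|) * 2 ^ (θ / 2)) lam, lt_max_of_lt_left (by positivity), ?_⟩⟩
    intro f K ν hf hF T hT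
    have hκ : 0 ≤ max κ 0 := le_max_right _ _
    have hs : OneSided f (max κ 0) := fun a b hab => (hf.oneSidedLipschitz a b hab).trans
      (mul_le_mul_of_nonneg_right (le_max_left _ _) (sub_pos.2 hab).le)
    refine ⟨isSolution_iff_eq_solutionMap hT hs hκ hf.continuous, fun x₀ => ⟨?_, fun E hE =>
      ⟨fun z₁ z₂ => ?_, fun z => ?_, fun hθν => hE.isSolution hf hθν⟩⟩⟩
    · obtain ⟨E, hE⟩ := exists_isContinuousExtension (x₀ := x₀) hT hθ hs hκ hf.continuous
      exact ⟨E, hE, fun E' hE' => hE'.unique hE⟩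
    · exact (hE.norm_sub_le hs hκ hf.continuous z₁ z₂).trans
        (mul_le_mul_of_nonneg_right (hmul _ T (by positivity) hT) (norm_nonneg _))
    · refine (hE.norm_le hs hκ hf.continuous z).trans
        (mul_le_mul_of_nonneg_right (le_trans ?_ (hmul _ T (by positivity) hT)) (by positivity))
      have : |f 0| ≤ |F| := hF.trans (le_abs_self F)
      gcongr
  · intro ν hν hνθ T hT x₀
    have hf := driftAssumption_one_sub_exp hν
    obtain ⟨E, hE⟩ := exists_isContinuousExtension (x₀ := x₀) hT hθ hf.oneSidedLipschitz le_rfl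
      hf.continuous
    -- The midpoint of `2/ν` and `θ`: below `θ`, so `|x - x₀|^α` lies in the weighted space, and
    -- above `2/ν`, so `exp(|x - x₀|^(αν))` outgrows every Gaussian.
    set α := (2 / ν + θ) / 2 with hα
    have hν2 : 0 < 2 / ν := by positivity
    have hq : 2 < α * ν := by
      have : 2 / ν < α := by linarith
      rwa [div_lt_iff₀ hν] at this
    obtain ⟨z, hz⟩ := exists_weightedC_rpow (θ := θ) T x₀ (by linarith : 0 ≤ α) (by linarith)
    -- At `s = 0` the solution is the datum; evaluating at `x = x₀` makes the integrand a function
    -- of `|y - x₀|` alone.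
    refine ⟨_, 0, 1, hf, E, hE, z, 0, T, x₀, le_rfl, hT, le_rfl,
      not_integrable_of_eventually_one_le_norm hd ?_⟩
    have hc : 0 < (2 * Real.pi * T) ^ (-(d : ℝ) / 2) := by positivity
    filter_upwards [(tendsto_norm_sub_cobounded x₀).eventually
      (eventually_one_le_mul_exp_sub hc (a := 1 / (2 * T)) (by positivity) hq)] with y hy
    have h0 : 0 ≤ ‖y - x₀‖ ^ α := Real.rpow_nonneg (norm_nonneg _) _
    have h1 : 0 ≤ ‖y - x₀‖ ^ (α * ν) := Real.rpow_nonneg (norm_nonneg _) _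
    rw [duhamelIntegrand, projIcc_left, hE.apply_zero hf.oneSidedLipschitz le_rfl hf.continuous,
      hz, max_eq_left h0, ← Real.rpow_mul (norm_nonneg _), sub_zero, norm_mul,
      Real.norm_of_nonneg (heatKernel_nonneg hT.le _), Real.norm_eq_abs, abs_sub_comm,
      abs_of_nonneg (by linarith [Real.one_le_exp h1]), heatKernel_sub_comm]
    exact hy
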